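/- Let $m\ge 1$ and $n\ge 0$ be integers. Consider pairs $(a,k)$ where $a$ is a set partition of the $2r$ points $1,\dots,r$ (top row) and $1',\dots,r'$ (bottom row), and $k\in\mathbb{Z}/N\mathbb{Z}$ is a number of internal components counted modulo $N$. They are multiplied by $(a,k)(b,l)=(ab,\,k+l+\Phi(a,b))$: stack $a$ on top of $b$, identifying the bottom points of $a$ with the top points of $b$; the blocks of $ab$ are the traces on the outer top and bottom rows of the connected components of the stacked diagram, and $\Phi(a,b)$ is the number of connected components that contain no point of the outer rows. The $N$-cyclic planar partition monoid $N\mathrm{pPa}_r$ consists of the pairs $(a,k)$ with $a$ planar, that is, with blocks that do not cross when the points are placed around a rectangle in the order $1,\dots,r,r',\dots,1'$; the $N$-cyclic Temperley–Lieb monoid $N\mathrm{TL}_r$ consists of the pairs $(a,k)$ with $a$ planar and all blocks of size two. In $m\mathrm{pPa}_n$ let $c$ be the identity diagram $\{\{j,j'\}\}_{j}$ with one internal component; for $1\le i\le n$ let $p_i$ be the diagram without internal components with blocks $\{i\}$, $\{i'\}$ and $\{j,j'\}$ for $j\ne i$; for $1\le i\le n-1$ let $p_{i+1/2}$ be the diagram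 without internal components with blocks $\{i,i+1,i',(i+1)'\}$ and $\{j,j'\}$ for $j\ne i,i+1$. In $2m\mathrm{TL}_{2n}$ let $o$ be the identity diagram with one internal component, and for $1\le i\le 2n-1$ let $u_i$ be the diagram without internal components with blocks $\{i,i+1\}$, $\{i',(i+1)'\}$ and $\{j,j'\}$ for $j\ne i,i+1$. Then there is an injective monoid homomorphism $f: m\mathrm{pPa}_n\hookrightarrow 2m\mathrm{TL}_{2n}$ with \[ f(p_i)=o\,u_{2i-1}\ (1\le i\le n),\qquad f(p_{i+1/2})=o^{2m-1}u_{2i}\ (1\le i\le n-1),\qquad f(c)=o^2. \] -/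

import Mathlib

namespace CyclicDiagram

/-! ## Gluing partitions

A partition of the points of a diagram with top row `X` and bottom row `Y` is a `Setoid (X ⊕ Y)`;
`Sum.inl` is the top row and `Sum.inr` is the bottom row. -/

section Glue

variable {X Y Z W : Type}

/-- The points of the upper diagram inside the three rows of the stacked diagram. -/
def upperPt : X ⊕ Y → X ⊕ Y ⊕ Z := Sum.map id Sum.inl

/-- The points of the top and bottom row inside the three rows of the stacked diagram. -/
def outerPt : X ⊕ Z → X ⊕ Y ⊕ Z := Sum.map id Sum.inr

/-- Two points of the stacked diagram lie in a common block of one of the two layers. -/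
inductive GlueStep (a : Setoid (X ⊕ Y)) (b : Setoid (Y ⊕ Z)) : X ⊕ Y ⊕ Z → X ⊕ Y ⊕ Z → Prop
  | upper {p q : X ⊕ Y} (h : a.r p q) : GlueStep a b (upperPt p) (upperPt q)
  | lower {p q : Y ⊕ Z} (h : b.r p q) : GlueStep a b (Sum.inr p) (Sum.inr q)

/-- The connected components of the diagram obtained by stacking `a` on top of `b`. -/
def glue (a : Setoid (X ⊕ Y)) (b : Setoid (Y ⊕ Z)) : Setoid (X ⊕ Y ⊕ Z) :=
  Relation.EqvGen.setoid (GlueStep a b)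

/-- The product of two partitions: stack `a` on top of `b` and forget the middle row. -/
def comp (a : Setoid (X ⊕ Y)) (b : Setoid (Y ⊕ Z)) : Setoid (X ⊕ Z) :=
  (glue a b).comap outerPt

/-- The number of internal components created by stacking `a` on top of `b`: the connected
components that contain no point of the top row and no point of the bottom row. -/
noncomputable def internalCount (a : Setoid (X ⊕ Y)) (b : Setoid (Y ⊕ Z)) : ℕ :=
  Nat.card {C : Quotient (glue a b) // ∀ p : X ⊕ Z, C ≠ Quotient.mk (glue a b) (outerPt p)}

/-- The identity partition, with the blocks `{x, x'}`. -/
def idPart (X : Type) : Setoid (X ⊕ X) := Setoid.ker (Sum.elim id id)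

/-! ### Associativity -/

section Pushout

variable {V U O O' P : Type} (i : V → U) (j : O' → U) (e : O → V) (k : O → O')
  (R : V → V → Prop) (S : O' → O' → Prop)

/-- The relation on `U` generated by `R` on `V` and `S` on `O'`. -/
inductive BigStep : U → U → Prop
  | left {v w : V} (h : R v w) : BigStep (i v) (i w)
  | right {v w : O'} (h : S v w) : BigStep (j v) (j w)

/-- The relation on `O'` generated by `S` and by the trace on `O` of the equivalence closure
of `R`. -/
inductive SmallStep : O' → O' → Prop
  | left {v w : O} (h : Relation.EqvGen R (e v) (e w)) : SmallStep (k v) (k w)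
  | right {v w : O'} (h : S v w) : SmallStep v w

/-- `u` is represented by the point `o` of `O'`. -/
def Rep (u : U) (o : O') : Prop :=
  u = j o ∨ ∃ v o₀, u = i v ∧ Relation.EqvGen R v (e o₀) ∧ o = k o₀

variable {i j e k R S}

theorem bigStep_of_eqvGen_left {v w : V} (h : Relation.EqvGen R v w) :
    Relation.EqvGen (BigStep i j R S) (i v) (i w) := by
  induction h with
  | rel _ _ h => exact .rel _ _ (.left h)
  | refl _ => exact .refl _
  | symm _ _ _ ih => exact .symm _ _ ih
  | trans _ _ _ _ _ ih ih' => exact .trans _ _ _ ih ih'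

theorem bigStep_of_smallStep (hij : ∀ o, i (e o) = j (k o)) {v w : O'}
    (h : Relation.EqvGen (SmallStep e k R S) v w) :
    Relation.EqvGen (BigStep i j R S) (j v) (j w) := by
  induction h with
  | rel _ _ h =>
    cases h with
    | left h => rw [← hij, ← hij]; exact bigStep_of_eqvGen_left h
    | right h => exact .rel _ _ (.right h)
  | refl _ => exact .refl _
  | symm _ _ _ ih => exact .symm _ _ ih
  | trans _ _ _ _ _ ih ih' => exact .trans _ _ _ ih ih'

theorem rep_unique (hi : Function.Injective i) (hj : Function.Injective j)
    (hp : ∀ v o', i v = j o' → ∃ o, v = e o ∧ o' = k o)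
    {u : U} {o₁ o₂ : O'} (h₁ : Rep i j e k R u o₁) (h₂ : Rep i j e k R u o₂) :
    Relation.EqvGen (SmallStep e k R S) o₁ o₂ := by
  rcases h₁ with h₁ | ⟨v₁, p₁, h₁, g₁, rfl⟩ <;> rcases h₂ with h₂ | ⟨v₂, p₂, h₂, g₂, rfl⟩
  · rw [hj (h₁.symm.trans h₂)]; exact .refl _
  · obtain ⟨o, rfl, rfl⟩ := hp _ _ (h₂.symm.trans h₁)
    exact .rel _ _ (.left g₂)
  · obtain ⟨o, rfl, rfl⟩ := hp _ _ (h₁.symm.trans h₂)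
    exact .symm _ _ (.rel _ _ (.left g₁))
  · obtain rfl := hi (h₁.symm.trans h₂)
    exact .rel _ _ (.left (.trans _ _ _ (.symm _ _ g₁) g₂))

theorem rep_not_inner (hi : Function.Injective i)
    (hp : ∀ v o', i v = j o' → ∃ o, v = e o ∧ o' = k o)
    {v : V} {o : O'} (h : Rep i j e k R (i v) o) : ∃ o, Relation.EqvGen R v (e o) := by
  rcases h with h | ⟨w, o₀, h, g, -⟩
  · obtain ⟨o, rfl, -⟩ := hp _ _ h
    exact ⟨o, .refl _⟩
  · obtain rfl := hi h
    exact ⟨o₀, g⟩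

theorem bigStep_cases (hi : Function.Injective i) (hj : Function.Injective j)
    (hc : ∀ u, (∃ v, u = i v) ∨ ∃ o, u = j o)
    (hp : ∀ v o', i v = j o' → ∃ o, v = e o ∧ o' = k o)
    {u u' : U} (h : Relation.EqvGen (BigStep i j R S) u u') :
    (∃ v v', u = i v ∧ u' = i v' ∧ Relation.EqvGen R v v' ∧ ∀ o, ¬ Relation.EqvGen R v (e o)) ∨
    ∃ o o', Rep i j e k R u o ∧ Rep i j e k R u' o' ∧
      Relation.EqvGen (SmallStep e k R S) o o' := by
  have hsplit : ∀ v v', Relation.EqvGen R v v' →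
      (∃ w w', i v = i w ∧ i v' = i w' ∧ Relation.EqvGen R w w' ∧
        ∀ o, ¬ Relation.EqvGen R w (e o)) ∨
      ∃ o o', Rep i j e k R (i v) o ∧ Rep i j e k R (i v') o' ∧
        Relation.EqvGen (SmallStep e k R S) o o' := by
    intro v v' h
    by_cases hv : ∃ o, Relation.EqvGen R v (e o)
    · obtain ⟨o, ho⟩ := hv
      exact .inr ⟨k o, k o, .inr ⟨v, o, rfl, ho, rfl⟩,
        .inr ⟨v', o, rfl, .trans _ _ _ (.symm _ _ h) ho, rfl⟩, .refl _⟩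
    · push Not at hv
      exact .inl ⟨v, v', rfl, rfl, h, hv⟩
  induction h with
  | rel _ _ h =>
    cases h with
    | left h => exact hsplit _ _ (.rel _ _ h)
    | right h => exact .inr ⟨_, _, .inl rfl, .inl rfl, .rel _ _ (.right h)⟩
  | refl u =>
    rcases hc u with ⟨v, rfl⟩ | ⟨o, rfl⟩
    · exact hsplit v v (.refl _)
    · exact .inr ⟨o, o, .inl rfl, .inl rfl, .refl _⟩
  | symm _ _ _ ih =>
    rcases ih with ⟨v, v', h, h', g, hv⟩ | ⟨o, o', h, h', g⟩
    · exact .inl ⟨v', v, h', h, .symm _ _ g, fun o ho => hv o (.trans _ _ _ g ho)⟩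
    · exact .inr ⟨o', o, h', h, .symm _ _ g⟩
  | trans _ y _ _ _ ih ih' =>
    rcases ih with ⟨v, v', h, h', g, hv⟩ | ⟨o, o', h, h', g⟩ <;>
      rcases ih' with ⟨w, w', h₂, h₂', g₂, hw⟩ | ⟨p, p', h₂, h₂', g₂⟩
    · obtain rfl := hi (h'.symm.trans h₂)
      exact .inl ⟨v, w', h, h₂', .trans _ _ _ g g₂, hv⟩
    · subst h'
      obtain ⟨o, ho⟩ := rep_not_inner hi hp h₂
      exact (hv o (.trans _ _ _ g ho)).elim
    · subst h₂
      obtain ⟨o, ho⟩ := rep_not_inner hi hp h'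
      exact (hw o ho).elim
    · exact .inr ⟨o, p', h, h₂', .trans _ _ _ g (.trans _ _ _ (rep_unique hi hj hp h' h₂) g₂)⟩

theorem bigStep_iff (hi : Function.Injective i) (hj : Function.Injective j)
    (hc : ∀ u, (∃ v, u = i v) ∨ ∃ o, u = j o)
    (hp : ∀ v o', i v = j o' → ∃ o, v = e o ∧ o' = k o) (hij : ∀ o, i (e o) = j (k o))
    (o o' : O') : Relation.EqvGen (BigStep i j R S) (j o) (j o') ↔
      Relation.EqvGen (SmallStep e k R S) o o' := by
  refine ⟨fun h => ?_, bigStep_of_smallStep hij⟩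
  rcases bigStep_cases hi hj hc hp h with ⟨v, v', h, -, -, hv⟩ | ⟨p, p', h, h', g⟩
  · obtain ⟨q, rfl, -⟩ := hp _ _ h.symm
    exact (hv q (.refl _)).elim
  · exact .trans _ _ _ (rep_unique hi hj hp (.inl rfl) h)
      (.trans _ _ _ g (rep_unique hi hj hp h' (.inl rfl)))

theorem bigStep_card [Finite V] [Finite O'] (w : P → O')
    (hi : Function.Injective i) (hj : Function.Injective j)
    (hc : ∀ u, (∃ v, u = i v) ∨ ∃ o, u = j o)
    (hp : ∀ v o', i v = j o' → ∃ o, v = e o ∧ o' = k o) (hij : ∀ o, i (e o) = j (k o)) :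
    Nat.card {C : Quotient (Relation.EqvGen.setoid (BigStep i j R S)) //
        ∀ p, C ≠ Quotient.mk _ (j (w p))} =
      Nat.card {C : Quotient (Relation.EqvGen.setoid R) // ∀ o, C ≠ Quotient.mk _ (e o)} +
      Nat.card {C : Quotient (Relation.EqvGen.setoid (SmallStep e k R S)) //
        ∀ p, C ≠ Quotient.mk _ (w p)} := by
  classical
  rw [← Nat.card_sum]
  symm
  have key : ∀ (v : V) (o : O'), (∀ o, ¬ Relation.EqvGen R v (e o)) →
      ¬ Relation.EqvGen (BigStep i j R S) (i v) (j o) := by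
    intro v o hv h
    rcases bigStep_cases hi hj hc hp h with ⟨x, x', -, h, g, hx⟩ | ⟨p, p', h, -, -⟩
    · obtain ⟨q, rfl, -⟩ := hp _ _ h.symm
      exact hx q g
    · obtain ⟨o, ho⟩ := rep_not_inner hi hp h
      exact hv o ho
  let F : {C : Quotient (Relation.EqvGen.setoid R) // ∀ o, C ≠ Quotient.mk _ (e o)} ⊕
      {C : Quotient (Relation.EqvGen.setoid (SmallStep e k R S)) //
        ∀ p, C ≠ Quotient.mk _ (w p)} → Quotient (Relation.EqvGen.setoid (BigStep i j R S)) :=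
    Sum.elim
      (fun C => Quotient.map' (s₂ := Relation.EqvGen.setoid (BigStep i j R S)) i
        (fun _ _ h => bigStep_of_eqvGen_left h) C.1)
      (fun C => Quotient.map' (s₂ := Relation.EqvGen.setoid (BigStep i j R S)) j
        (fun _ _ h => bigStep_of_smallStep hij h) C.1)
  have hF : ∀ x, ∀ p, F x ≠ Quotient.mk _ (j (w p)) := by
    rintro (⟨C, hC⟩ | ⟨C, hC⟩) p h
    · induction C using Quotient.inductionOn with | _ v =>
      exact key v (w p) (fun o ho => hC o (Quotient.sound ho)) (Quotient.exact h)
    · induction C using Quotient.inductionOn with | _ v =>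
      exact hC p (Quotient.sound ((bigStep_iff hi hj hc hp hij _ _).1 (Quotient.exact h)))
  refine Nat.card_congr (Equiv.ofBijective (fun x => ⟨F x, hF x⟩) ⟨?_, ?_⟩)
  · intro x y hxy
    have hxy : F x = F y := congrArg Subtype.val hxy
    rcases x with ⟨C, hC⟩ | ⟨C, hC⟩ <;> rcases y with ⟨D, hD⟩ | ⟨D, hD⟩ <;>
      induction C using Quotient.inductionOn with | _ v =>
      induction D using Quotient.inductionOn with | _ v' =>
      have hxy := Quotient.exact hxy
      first
        | exact (key v v' (fun o ho => hC o (Quotient.sound ho)) hxy).elim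
        | exact (key v' v (fun o ho => hD o (Quotient.sound ho)) (.symm _ _ hxy)).elim
        | (have := (bigStep_iff hi hj hc hp hij _ _).1 hxy
           congr 2
           exact Quotient.sound this)
        | (have : Relation.EqvGen R v v' := by
             rcases bigStep_cases hi hj hc hp hxy with ⟨x, x', h, h', g, hx⟩ | ⟨p, p', h, -, -⟩
             · obtain rfl := hi h
               obtain rfl := hi h'
               exact g
             · obtain ⟨o, ho⟩ := rep_not_inner hi hp h
               exact (hC o (Quotient.sound ho)).elim
           congr 2
           exact Quotient.sound this)
  · rintro ⟨C, hC⟩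
    induction C using Quotient.inductionOn with | _ u =>
    have hright : ∀ o, Relation.EqvGen (BigStep i j R S) u (j o) → ∃ x, F x = Quotient.mk _ u := by
      intro o ho
      refine ⟨.inr ⟨Quotient.mk _ o, fun p h => hC p ?_⟩, Quotient.sound (.symm _ _ ho)⟩
      exact Quotient.sound (.trans _ _ _ ho (bigStep_of_smallStep hij (Quotient.exact h)))
    suffices h : ∃ x, F x = Quotient.mk _ u by
      obtain ⟨x, hx⟩ := h
      exact ⟨x, Subtype.ext hx⟩
    rcases hc u with ⟨v, rfl⟩ | ⟨o, rfl⟩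
    · by_cases hv : ∃ o, Relation.EqvGen R v (e o)
      · obtain ⟨o, ho⟩ := hv
        exact hright (k o) (hij o ▸ bigStep_of_eqvGen_left ho)
      · push Not at hv
        exact ⟨.inl ⟨Quotient.mk _ v, fun o h => hv o (Quotient.exact h)⟩, rfl⟩
    · exact hright o (.refl _)

end Pushout

/-- The relation on the four rows of a stack of three diagrams: two points lie in a common block
of one of the three layers. -/
inductive TriStep (a : Setoid (X ⊕ Y)) (b : Setoid (Y ⊕ Z)) (c : Setoid (Z ⊕ W)) :
    X ⊕ Y ⊕ Z ⊕ W → X ⊕ Y ⊕ Z ⊕ W → Prop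
  | first {p q : X ⊕ Y} (h : a.r p q) : TriStep a b c (upperPt p) (upperPt q)
  | second {p q : Y ⊕ Z} (h : b.r p q) : TriStep a b c (.inr (upperPt p)) (.inr (upperPt q))
  | third {p q : Z ⊕ W} (h : c.r p q) : TriStep a b c (.inr (.inr p)) (.inr (.inr q))

/-- The two bottom layers of a stack of two diagrams, as a relation on its three rows. -/
inductive LowerStep (c : Setoid (Z ⊕ W)) : X ⊕ Z ⊕ W → X ⊕ Z ⊕ W → Prop
  | mk {p q : Z ⊕ W} (h : c.r p q) : LowerStep c (.inr p) (.inr q)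

/-- The upper layer of a stack of two diagrams, as a relation on its three rows. -/
inductive UpperStep (a : Setoid (X ⊕ Y)) : X ⊕ Y ⊕ W → X ⊕ Y ⊕ W → Prop
  | mk {p q : X ⊕ Y} (h : a.r p q) : UpperStep a (upperPt p) (upperPt q)

/-- The three top rows of four rows. -/
def topThree : X ⊕ Y ⊕ Z → X ⊕ Y ⊕ Z ⊕ W := Sum.map id (Sum.map id Sum.inl)

theorem triStep_left (a : Setoid (X ⊕ Y)) (b : Setoid (Y ⊕ Z)) (c : Setoid (Z ⊕ W)) :
    TriStep a b c = BigStep topThree outerPt (GlueStep a b) (LowerStep c) := by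
  funext u v
  refine propext ⟨?_, ?_⟩
  · rintro (@⟨p, q, h⟩ | @⟨p, q, h⟩ | @⟨p, q, h⟩)
    · have := BigStep.left (i := topThree) (j := outerPt) (S := LowerStep (X := X) c)
        (GlueStep.upper (b := b) h)
      rcases p with p | p <;> rcases q with q | q <;> exact this
    · have := BigStep.left (i := topThree) (j := outerPt) (S := LowerStep (X := X) c)
        (GlueStep.lower (a := a) h)
      rcases p with p | p <;> rcases q with q | q <;> exact this
    · exact BigStep.right (i := topThree) (j := outerPt) (R := GlueStep a b)
        (LowerStep.mk (X := X) h)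
  · rintro ((@⟨p, q, h⟩ | @⟨p, q, h⟩) | ⟨@⟨p, q, h⟩⟩)
    · have := TriStep.first (b := b) (c := c) h
      rcases p with p | p <;> rcases q with q | q <;> exact this
    · have := TriStep.second (a := a) (c := c) h
      rcases p with p | p <;> rcases q with q | q <;> exact this
    · exact TriStep.third h

theorem triStep_right (a : Setoid (X ⊕ Y)) (b : Setoid (Y ⊕ Z)) (c : Setoid (Z ⊕ W)) :
    TriStep a b c = BigStep Sum.inr (Sum.map id outerPt) (GlueStep b c)
      (UpperStep (W := W) a) := by
  funext u v
  refine propext ⟨?_, ?_⟩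
  · rintro (@⟨p, q, h⟩ | @⟨p, q, h⟩ | @⟨p, q, h⟩)
    · have := BigStep.right (i := Sum.inr) (j := Sum.map id outerPt) (R := GlueStep b c)
        (UpperStep.mk (W := W) h)
      rcases p with p | p <;> rcases q with q | q <;> exact this
    · exact .left (.upper h)
    · exact .left (.lower h)
  · rintro ((@⟨p, q, h⟩ | @⟨p, q, h⟩) | ⟨@⟨p, q, h⟩⟩)
    · exact .second h
    · exact .third h
    · have := TriStep.first (b := b) (c := c) h
      rcases p with p | p <;> rcases q with q | q <;> exact this

theorem glueStep_comp_left (a : Setoid (X ⊕ Y)) (b : Setoid (Y ⊕ Z)) (c : Setoid (Z ⊕ W)) :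
    GlueStep (comp a b) c = SmallStep outerPt upperPt (GlueStep a b) (LowerStep c) := by
  funext u v
  refine propext ⟨?_, ?_⟩
  · rintro (h | h)
    · exact .left h
    · exact .right (.mk h)
  · rintro (h | ⟨⟨h⟩⟩)
    · exact .upper h
    · exact .lower h

theorem glueStep_comp_right (a : Setoid (X ⊕ Y)) (b : Setoid (Y ⊕ Z)) (c : Setoid (Z ⊕ W)) :
    GlueStep a (comp b c) = SmallStep outerPt Sum.inr (GlueStep b c) (UpperStep (W := W) a) := by
  funext u v
  refine propext ⟨?_, ?_⟩
  · rintro (h | h)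
    · exact .right (.mk h)
    · exact .left h
  · rintro (h | ⟨⟨h⟩⟩)
    · exact .lower h
    · exact .upper h

theorem left_pushout_data :
    Function.Injective (topThree : X ⊕ Y ⊕ Z → X ⊕ Y ⊕ Z ⊕ W) ∧
    Function.Injective (outerPt : X ⊕ Z ⊕ W → X ⊕ Y ⊕ Z ⊕ W) ∧
    (∀ u : X ⊕ Y ⊕ Z ⊕ W, (∃ v, u = topThree v) ∨ ∃ o, u = outerPt o) ∧
    (∀ (v : X ⊕ Y ⊕ Z) (o' : X ⊕ Z ⊕ W), topThree v = (outerPt o' : X ⊕ Y ⊕ Z ⊕ W) →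
      ∃ o : X ⊕ Z, v = outerPt o ∧ o' = upperPt o) ∧
    ∀ o : X ⊕ Z, (topThree (outerPt o) : X ⊕ Y ⊕ Z ⊕ W) = outerPt (upperPt o) := by
  refine ⟨?_, ?_, ?_, ?_, ?_⟩
  · rintro (_ | _ | _) (_ | _ | _) h <;> simp_all [topThree]
  · rintro (_ | _ | _) (_ | _ | _) h <;> simp_all [outerPt]
  · rintro (x | y | z | w)
    · exact .inl ⟨.inl x, rfl⟩
    · exact .inl ⟨.inr (.inl y), rfl⟩
    · exact .inl ⟨.inr (.inr z), rfl⟩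
    · exact .inr ⟨.inr (.inr w), rfl⟩
  · rintro (_ | _ | _) (_ | _ | _) h <;> simp_all [topThree, outerPt, upperPt]
  · rintro (_ | _) <;> rfl

theorem right_pushout_data :
    Function.Injective (Sum.inr : Y ⊕ Z ⊕ W → X ⊕ Y ⊕ Z ⊕ W) ∧
    Function.Injective (Sum.map id outerPt : X ⊕ Y ⊕ W → X ⊕ Y ⊕ Z ⊕ W) ∧
    (∀ u : X ⊕ Y ⊕ Z ⊕ W, (∃ v, u = Sum.inr v) ∨ ∃ o : X ⊕ Y ⊕ W, u = Sum.map id outerPt o) ∧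
    (∀ (v : Y ⊕ Z ⊕ W) (o' : X ⊕ Y ⊕ W), Sum.inr v = (Sum.map id outerPt o' : X ⊕ Y ⊕ Z ⊕ W) →
      ∃ o : Y ⊕ W, v = outerPt o ∧ o' = Sum.inr o) ∧
    ∀ o : Y ⊕ W, (Sum.inr (outerPt o) : X ⊕ Y ⊕ Z ⊕ W) = Sum.map id outerPt (Sum.inr o) := by
  refine ⟨Sum.inr_injective, ?_, ?_, ?_, ?_⟩
  · rintro (_ | _ | _) (_ | _ | _) h <;> simp_all [outerPt]
  · rintro (x | v)
    · exact .inr ⟨.inl x, rfl⟩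
    · exact .inl ⟨v, rfl⟩
  · rintro (_ | _ | _) (_ | _ | _) h <;> simp_all [outerPt]
  · rintro (_ | _) <;> rfl

theorem comp_assoc (a : Setoid (X ⊕ Y)) (b : Setoid (Y ⊕ Z)) (c : Setoid (Z ⊕ W)) :
    comp (comp a b) c = comp a (comp b c) := by
  obtain ⟨h₁, h₂, h₃, h₄, h₅⟩ := left_pushout_data (X := X) (Y := Y) (Z := Z) (W := W)
  obtain ⟨g₁, g₂, g₃, g₄, g₅⟩ := right_pushout_data (X := X) (Y := Y) (Z := Z) (W := W)
  refine Setoid.ext fun p q => ?_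
  have hl : (comp (comp a b) c) p q ↔ Relation.EqvGen (TriStep a b c)
      (outerPt (outerPt p)) (outerPt (outerPt q)) := by
    rw [triStep_left, bigStep_iff h₁ h₂ h₃ h₄ h₅, ← glueStep_comp_left]; rfl
  have hr : (comp a (comp b c)) p q ↔ Relation.EqvGen (TriStep a b c)
      (Sum.map id outerPt (outerPt p)) (Sum.map id outerPt (outerPt q)) := by
    rw [triStep_right, bigStep_iff g₁ g₂ g₃ g₄ g₅, ← glueStep_comp_right]; rfl
  have he : ∀ p : X ⊕ W, (outerPt (outerPt p) : X ⊕ Y ⊕ Z ⊕ W) = Sum.map id outerPt (outerPt p) := by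
    rintro (_ | _) <;> rfl
  rw [hl, hr, he, he]

theorem internalCount_assoc [Finite X] [Finite Y] [Finite Z] [Finite W]
    (a : Setoid (X ⊕ Y)) (b : Setoid (Y ⊕ Z)) (c : Setoid (Z ⊕ W)) :
    internalCount a b + internalCount (comp a b) c =
      internalCount b c + internalCount a (comp b c) := by
  obtain ⟨h₁, h₂, h₃, h₄, h₅⟩ := left_pushout_data (X := X) (Y := Y) (Z := Z) (W := W)
  obtain ⟨g₁, g₂, g₃, g₄, g₅⟩ := right_pushout_data (X := X) (Y := Y) (Z := Z) (W := W)
  have hl := bigStep_card (R := GlueStep a b) (S := LowerStep c)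
    (outerPt : X ⊕ W → X ⊕ Z ⊕ W) h₁ h₂ h₃ h₄ h₅
  have hr := bigStep_card (R := GlueStep b c) (S := UpperStep a)
    (outerPt : X ⊕ W → X ⊕ Y ⊕ W) g₁ g₂ g₃ g₄ g₅
  rw [← triStep_left, ← glueStep_comp_left] at hl
  rw [← triStep_right, ← glueStep_comp_right] at hr
  have he : ∀ p : X ⊕ W, (outerPt (outerPt p) : X ⊕ Y ⊕ Z ⊕ W) = Sum.map id outerPt (outerPt p) := by
    rintro (_ | _) <;> rfl
  simp only [he] at hl
  exact hl.symm.trans hr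

/-! ### Identities -/

theorem glue_idPart_left (a : Setoid (X ⊕ Z)) (u v : X ⊕ X ⊕ Z) :
    (glue (idPart X) a) u v ↔ a (Sum.elim Sum.inl id u) (Sum.elim Sum.inl id v) := by
  constructor
  · intro h
    induction h with
    | rel _ _ h =>
      rcases h with @⟨p, q, h⟩ | h
      · have h : Sum.elim id id p = Sum.elim id id q := h
        rcases p with p | p <;> rcases q with q | q <;> obtain rfl : p = q := h <;> exact a.refl _
      · exact h
    | refl _ => exact a.refl _
    | symm _ _ _ ih => exact a.symm ih
    | trans _ _ _ _ _ ih ih' => exact a.trans ih ih'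
  · intro h
    have key : ∀ u : X ⊕ X ⊕ Z, (glue (idPart X) a) u (Sum.inr (Sum.elim Sum.inl id u)) := by
      rintro (x | u)
      · exact .rel _ _ (.upper (p := .inl x) (q := .inr x) rfl)
      · exact .refl _
    exact .trans _ _ _ (key u) (.trans _ _ _ (.rel _ _ (.lower h)) (.symm _ _ (key v)))

theorem glue_idPart_right (a : Setoid (X ⊕ Z)) (u v : X ⊕ Z ⊕ Z) :
    (glue a (idPart Z)) u v ↔
      a (Sum.map id (Sum.elim id id) u) (Sum.map id (Sum.elim id id) v) := by
  constructor
  · intro h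
    induction h with
    | rel _ _ h =>
      rcases h with @⟨p, q, h⟩ | @⟨p, q, h⟩
      · rcases p with p | p <;> rcases q with q | q <;> exact h
      · have h : Sum.elim id id p = Sum.elim id id q := h
        rcases p with p | p <;> rcases q with q | q <;> obtain rfl : p = q := h <;> exact a.refl _
    | refl _ => exact a.refl _
    | symm _ _ _ ih => exact a.symm ih
    | trans _ _ _ _ _ ih ih' => exact a.trans ih ih'
  · intro h
    have key : ∀ u : X ⊕ Z ⊕ Z,
        (glue a (idPart Z)) u (upperPt (Sum.map id (Sum.elim id id) u)) := by
      rintro (x | z | z)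
      · exact .refl _
      · exact .refl _
      · exact .rel _ _ (.lower (p := .inr z) (q := .inl z) rfl)
    exact .trans _ _ _ (key u) (.trans _ _ _ (.rel _ _ (.upper h)) (.symm _ _ (key v)))

theorem idPart_comp (a : Setoid (X ⊕ Z)) : comp (idPart X) a = a := by
  refine Setoid.ext fun p q => (glue_idPart_left a _ _).trans ?_
  rcases p with p | p <;> rcases q with q | q <;> rfl

theorem comp_idPart (a : Setoid (X ⊕ Z)) : comp a (idPart Z) = a := by
  refine Setoid.ext fun p q => (glue_idPart_right a _ _).trans ?_
  rcases p with p | p <;> rcases q with q | q <;> rfl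

theorem internalCount_idPart_left (a : Setoid (X ⊕ Z)) : internalCount (idPart X) a = 0 := by
  have : IsEmpty {C : Quotient (glue (idPart X) a) //
      ∀ p : X ⊕ Z, C ≠ Quotient.mk (glue (idPart X) a) (outerPt p)} := by
    refine ⟨fun ⟨C, hC⟩ => ?_⟩
    induction C using Quotient.inductionOn with | _ u =>
    refine hC (Sum.elim Sum.inl id u) (Quotient.sound ((glue_idPart_left a _ _).2 ?_))
    rcases u with x | x | z <;> exact a.refl _
  exact Nat.card_of_isEmpty

theorem internalCount_idPart_right (a : Setoid (X ⊕ Z)) : internalCount a (idPart Z) = 0 := by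
  have : IsEmpty {C : Quotient (glue a (idPart Z)) //
      ∀ p : X ⊕ Z, C ≠ Quotient.mk (glue a (idPart Z)) (outerPt p)} := by
    refine ⟨fun ⟨C, hC⟩ => ?_⟩
    induction C using Quotient.inductionOn with | _ u =>
    refine hC (Sum.map id (Sum.elim id id) u) (Quotient.sound ((glue_idPart_right a _ _).2 ?_))
    rcases u with x | x | z <;> exact a.refl _
  exact Nat.card_of_isEmpty

end Glue

/-! ## The cyclic partition monoid -/

/-- A partition of the `2n` points `1, …, n` (top row) and `1', …, n'` (bottom row), together with
a number of internal components modulo `m`. The point `i` of a row is the element `i - 1` of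
`Fin n`. -/
@[ext]
structure CyclicPartition (m n : ℕ) where
  /-- the partition of the points -/
  skeleton : Setoid (Fin n ⊕ Fin n)
  /-- the number of internal components modulo `m` -/
  internal : ZMod m

namespace CyclicPartition

variable {m n : ℕ}

/-- Diagrams are multiplied by stacking, the left factor on top; the internal components are those
of the factors and those created by the stacking. -/
noncomputable instance : Monoid (CyclicPartition m n) where
  mul a b := ⟨comp a.skeleton b.skeleton,
    a.internal + b.internal + (internalCount a.skeleton b.skeleton : ZMod m)⟩
  one := ⟨idPart (Fin n), 0⟩
  mul_assoc a b c := by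
    refine CyclicPartition.ext (comp_assoc _ _ _) ?_
    have h := congrArg (Nat.cast : ℕ → ZMod m)
      (internalCount_assoc a.skeleton b.skeleton c.skeleton)
    push_cast at h
    change a.internal + b.internal + (internalCount a.skeleton b.skeleton : ZMod m) + c.internal +
      (internalCount (comp a.skeleton b.skeleton) c.skeleton : ZMod m) = a.internal +
      (b.internal + c.internal + (internalCount b.skeleton c.skeleton : ZMod m)) +
      (internalCount a.skeleton (comp b.skeleton c.skeleton) : ZMod m)
    linear_combination h
  one_mul a := by
    refine CyclicPartition.ext (idPart_comp _) ?_
    change 0 + a.internal + (internalCount (idPart (Fin n)) a.skeleton : ZMod m) = a.internal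
    simp [internalCount_idPart_left]
  mul_one a := by
    refine CyclicPartition.ext (comp_idPart _) ?_
    change a.internal + 0 + (internalCount a.skeleton (idPart (Fin n)) : ZMod m) = a.internal
    simp [internalCount_idPart_right]

end CyclicPartition

/-! ## Planar partitions -/

/-- The position of a point on the boundary of the strip, going around it: `1, …, n` along the top
row and then `n', …, 1'` along the bottom row. -/
def pos {n : ℕ} : Fin n ⊕ Fin n → ℤ
  | .inl i => i.val
  | .inr i => 2 * n - 1 - i.val

/-- A partition is planar if its blocks do not cross. -/
def IsPlanar {n : ℕ} (a : Setoid (Fin n ⊕ Fin n)) : Prop :=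
  ∀ p q r s : Fin n ⊕ Fin n, pos p < pos q → pos q < pos r → pos r < pos s →
    a p r → a q s → a p q

/-- All blocks have size two. -/
def IsMatching {n : ℕ} (a : Setoid (Fin n ⊕ Fin n)) : Prop :=
  ∀ p : Fin n ⊕ Fin n, ∃! q : Fin n ⊕ Fin n, q ≠ p ∧ a p q

section Planar

variable {n : ℕ}

theorem pos_injective : Function.Injective (pos : Fin n ⊕ Fin n → ℤ) := by
  rintro (p | p) (q | q) h <;> simp only [pos] at h
  · congr 1; ext; omega
  · have := p.2; have := q.2; omega
  · have := p.2; have := q.2; omega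
  · congr 1; ext; omega

/-- The number of the points `x`, `z` that come before `r` is even or odd in the same way for all
`r` in one block. -/
theorem IsPlanar.parity {a : Setoid (Fin n ⊕ Fin n)} (ha : IsPlanar a) {x z r s : Fin n ⊕ Fin n}
    (hxz : a x z) (hrs : a r s) (hxr : ¬ a x r) :
    xor (decide (pos x < pos r)) (decide (pos z < pos r)) =
      xor (decide (pos x < pos s)) (decide (pos z < pos s)) := by
  have hne : ∀ u v, a x u → a r v → pos u ≠ pos v := by
    intro u v hu hv h
    obtain rfl := pos_injective h
    exact hxr (a.trans hu (a.symm hv))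
  have aux : ∀ x z r s : Fin n ⊕ Fin n, a x z → a r s → ¬ a x r → pos x ≠ pos r → pos x ≠ pos s →
      pos z ≠ pos r → pos z ≠ pos s → pos x ≤ pos z → pos r ≤ pos s →
      xor (decide (pos x < pos r)) (decide (pos z < pos r)) =
        xor (decide (pos x < pos s)) (decide (pos z < pos s)) := by
    intro x z r s hxz hrs hxr h₁ h₂ h₃ h₄ h₅ h₆
    have c₁ : ¬ (pos x < pos r ∧ pos r < pos z ∧ pos z < pos s) := fun h =>
      hxr (ha _ _ _ _ h.1 h.2.1 h.2.2 hxz hrs)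
    have c₂ : ¬ (pos r < pos x ∧ pos x < pos s ∧ pos s < pos z) := fun h =>
      hxr (a.symm (ha _ _ _ _ h.1 h.2.1 h.2.2 hrs hxz))
    by_cases hxr : pos x < pos r <;> by_cases hzr : pos z < pos r <;>
      by_cases hxs : pos x < pos s <;> by_cases hzs : pos z < pos s <;>
      simp only [hxr, hzr, hxs, hzs] <;> first | rfl | omega
  have n₁ := hne x r (a.refl _) (a.refl _)
  have n₂ := hne x s (a.refl _) hrs
  have n₃ := hne z r hxz (a.refl _)
  have n₄ := hne z s hxz hrs
  have hzr : ¬ a z r := fun h => hxr (a.trans hxz h)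
  have hxs : ¬ a x s := fun h => hxr (a.trans h (a.symm hrs))
  have hzs : ¬ a z s := fun h => hzr (a.trans h (a.symm hrs))
  rcases le_total (pos x) (pos z) with h | h <;> rcases le_total (pos r) (pos s) with h' | h'
  · exact aux x z r s hxz hrs hxr n₁ n₂ n₃ n₄ h h'
  · exact (aux x z s r hxz (a.symm hrs) hxs n₂ n₁ n₄ n₃ h h').symm
  · rw [Bool.xor_comm, aux z x r s (a.symm hxz) hrs hzr n₃ n₄ n₁ n₂ h h', Bool.xor_comm]
  · rw [Bool.xor_comm, ← aux z x s r (a.symm hxz) (a.symm hrs) hzs n₄ n₃ n₂ n₁ h h', Bool.xor_comm]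

theorem isPlanar_of_parity {a : Setoid (Fin n ⊕ Fin n)}
    (ha : ∀ x z r s : Fin n ⊕ Fin n, a x z → a r s → ¬ a x r →
      xor (decide (pos x < pos r)) (decide (pos z < pos r)) =
        xor (decide (pos x < pos s)) (decide (pos z < pos s))) : IsPlanar a := by
  intro p q r s h₁ h₂ h₃ hpr hqs
  by_contra h
  have := ha p r q s hpr hqs h
  have e₁ : ¬ pos r < pos q := by omega
  have e₂ : pos p < pos s := by omega
  simp [h₁, h₃, e₁, e₂] at this

theorem IsPlanar.parity' {a : Setoid (Fin n ⊕ Fin n)} (ha : IsPlanar a) {x z r s : Fin n ⊕ Fin n}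
    (hxz : a x z) (hrs : a r s) (hxr : ¬ a x r) :
    xor (decide (pos r < pos x)) (decide (pos r < pos z)) =
      xor (decide (pos s < pos x)) (decide (pos s < pos z)) := by
  have hne : ∀ u v, a x u → a r v → decide (pos v < pos u) = !decide (pos u < pos v) := by
    intro u v hu hv
    have h : pos u ≠ pos v := by
      intro h
      obtain rfl := pos_injective h
      exact hxr (a.trans hu (a.symm hv))
    rw [← decide_not, decide_eq_decide]
    omega
  rw [hne x r (a.refl _) (a.refl _), hne x s (a.refl _) hrs, hne z r hxz (a.refl _),
    hne z s hxz hrs, Bool.not_xor_not, Bool.not_xor_not]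
  exact ha.parity hxz hrs hxr

/-- The position of a point relative to a point of the top row. -/
def topMark (r : Fin n) : Fin n ⊕ Fin n ⊕ Fin n → Bool
  | .inl t => decide (t < r)
  | _ => false

/-- The position of a point relative to a point of the middle row. -/
def middleMark (r : Fin n) : Fin n ⊕ Fin n ⊕ Fin n → Bool
  | .inr (.inl y) => decide (r < y)
  | _ => true

/-- The position of a point relative to a point of the bottom row. -/
def bottomMark (r : Fin n) : Fin n ⊕ Fin n ⊕ Fin n → Bool
  | .inr (.inr t) => decide (t < r)
  | _ => false

theorem upper_marks (p : Fin n ⊕ Fin n) (r : Fin n) :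
    decide (pos p < pos (.inl r)) = topMark r (upperPt p) ∧
    decide (pos p < pos (.inr r)) = middleMark r (upperPt p) ∧
    bottomMark r (upperPt p) = false := by
  rcases p with p | p <;> have := p.2 <;> have := r.2
  · refine ⟨?_, ?_, rfl⟩
    · change decide ((p : ℤ) < r) = decide (p.val < r.val)
      rw [decide_eq_decide]; omega
    · change decide ((p : ℤ) < 2 * n - 1 - r) = true
      rw [decide_eq_true_eq]; omega
  · refine ⟨?_, ?_, rfl⟩
    · change decide (2 * (n : ℤ) - 1 - p < r) = false
      rw [decide_eq_false_iff_not]; omega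
    · change decide (2 * (n : ℤ) - 1 - p < 2 * (n : ℤ) - 1 - r) = decide (r.val < p.val)
      rw [decide_eq_decide]; omega

theorem lower_marks (p : Fin n ⊕ Fin n) (r : Fin n) :
    topMark r (.inr p) = false ∧
    decide (pos (.inl r) < pos p) = middleMark r (.inr p) ∧
    decide (pos (.inr r) < pos p) = bottomMark r (.inr p) := by
  rcases p with p | p <;> have := p.2 <;> have := r.2
  · refine ⟨rfl, ?_, ?_⟩
    · change decide ((r : ℤ) < p) = decide (r.val < p.val)
      rw [decide_eq_decide]; omega
    · change decide (2 * (n : ℤ) - 1 - r < p) = false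
      rw [decide_eq_false_iff_not]; omega
  · refine ⟨rfl, ?_, ?_⟩
    · change decide ((r : ℤ) < 2 * n - 1 - p) = true
      rw [decide_eq_true_eq]; omega
    · change decide (2 * (n : ℤ) - 1 - r < 2 * (n : ℤ) - 1 - p) = decide (p.val < r.val)
      rw [decide_eq_decide]; omega

theorem glue_parity {a b : Setoid (Fin n ⊕ Fin n)} (ha : IsPlanar a) (hb : IsPlanar b)
    {x z : Fin n ⊕ Fin n ⊕ Fin n} (h : (glue a b) x z) :
    ∃ F G : Fin n ⊕ Fin n → Bool,
      (∀ r s, a r s → ¬ (glue a b) x (upperPt r) → F r = F s) ∧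
      (∀ r s, b r s → ¬ (glue a b) x (Sum.inr r) → G r = G s) ∧
      ∀ r : Fin n, F (.inl r) = xor (topMark r x) (topMark r z) ∧
        G (.inr r) = xor (bottomMark r x) (bottomMark r z) ∧
        xor (F (.inr r)) (G (.inl r)) = xor (middleMark r x) (middleMark r z) := by
  induction h with
  | rel x z h =>
    rcases h with @⟨p, q, h⟩ | @⟨p, q, h⟩
    · refine ⟨fun r => xor (decide (pos p < pos r)) (decide (pos q < pos r)), fun _ => false,
        fun r s hrs hr => ha.parity h hrs fun hpr => hr (.rel _ _ (.upper hpr)),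
        fun _ _ _ _ => rfl, fun r => ?_⟩
      obtain ⟨h₁, h₂, h₃⟩ := upper_marks p r
      obtain ⟨h₄, h₅, h₆⟩ := upper_marks q r
      simp only [h₁, h₂, h₃, h₄, h₅, h₆, Bool.xor_false, and_self]
    · refine ⟨fun _ => false, fun r => xor (decide (pos r < pos p)) (decide (pos r < pos q)),
        fun _ _ _ _ => rfl,
        fun r s hrs hr => hb.parity' h hrs fun hpr => hr (.rel _ _ (.lower hpr)), fun r => ?_⟩
      obtain ⟨h₁, h₂, h₃⟩ := lower_marks p r
      obtain ⟨h₄, h₅, h₆⟩ := lower_marks q r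
      simp only [h₁, h₂, h₃, h₄, h₅, h₆, Bool.xor_false, Bool.false_xor, and_self]
  | refl x => exact ⟨fun _ => false, fun _ => false, by simp⟩
  | symm x z h ih =>
    obtain ⟨F, G, h₁, h₂, h₃⟩ := ih
    refine ⟨F, G, fun r s hrs hr => h₁ r s hrs fun h' => hr (.trans _ _ _ (.symm _ _ h) h'),
      fun r s hrs hr => h₂ r s hrs fun h' => hr (.trans _ _ _ (.symm _ _ h) h'), fun r => ?_⟩
    rw [Bool.xor_comm (topMark r z), Bool.xor_comm (bottomMark r z),
      Bool.xor_comm (middleMark r z)]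
    exact h₃ r
  | trans x y z h h' ih ih' =>
    obtain ⟨F, G, h₁, h₂, h₃⟩ := ih
    obtain ⟨F', G', h₁', h₂', h₃'⟩ := ih'
    refine ⟨fun r => xor (F r) (F' r), fun r => xor (G r) (G' r), ?_, ?_, fun r => ?_⟩
    · intro r s hrs hr
      exact congrArg₂ _ (h₁ r s hrs hr) (h₁' r s hrs fun h'' => hr (.trans _ _ _ h h''))
    · intro r s hrs hr
      exact congrArg₂ _ (h₂ r s hrs hr) (h₂' r s hrs fun h'' => hr (.trans _ _ _ h h''))
    · obtain ⟨e₁, e₂, e₃⟩ := h₃ r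
      obtain ⟨e₁', e₂', e₃'⟩ := h₃' r
      have key : ∀ A B C : Bool, xor (xor A B) (xor B C) = xor A C := by decide
      have key' : ∀ A B C D : Bool, xor (xor A B) (xor C D) = xor (xor A C) (xor B D) := by decide
      refine ⟨?_, ?_, ?_⟩
      · simp only [e₁, e₁', key]
      · simp only [e₂, e₂', key]
      · rw [← key (middleMark r x) (middleMark r y), ← e₃, ← e₃']
        exact key' _ _ _ _

theorem outer_marks (x r : Fin n ⊕ Fin n) (h : x ≠ r) :
    decide (pos x < pos r) = r.elim (fun t => topMark t (outerPt x))
      (fun t => !bottomMark t (outerPt x)) := by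
  have h' : ∀ u v : Fin n, u ≠ v → u.val ≠ v.val := fun _ _ h h' => h (Fin.ext h')
  rcases x with x | x <;> rcases r with r | r <;> have := x.2 <;> have := r.2
  · simp [pos, outerPt, topMark]
  · change decide ((x : ℤ) < 2 * n - 1 - r) = true
    rw [decide_eq_true_eq]; omega
  · change decide (2 * (n : ℤ) - 1 - x < r) = false
    rw [decide_eq_false_iff_not]; omega
  · have := h' x r fun h' => h (congrArg _ h')
    change decide (2 * (n : ℤ) - 1 - x < 2 * (n : ℤ) - 1 - r) = !decide (x.val < r.val)
    rw [← decide_not, decide_eq_decide]; omega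

/-- Stacking planar partitions gives a planar partition. -/
theorem IsPlanar.comp {a b : Setoid (Fin n ⊕ Fin n)} (ha : IsPlanar a) (hb : IsPlanar b) :
    IsPlanar (comp a b) := by
  refine isPlanar_of_parity fun x z r s hxz hrs hxr => ?_
  obtain ⟨F, G, h₁, h₂, h₃⟩ := glue_parity ha hb hxz
  have hmid : ∀ x : Fin n ⊕ Fin n, ∀ t, middleMark t (outerPt x) = true := by
    rintro (x | x) t <;> rfl
  let H : Fin n ⊕ Fin n ⊕ Fin n → Bool := Sum.elim (fun t => F (.inl t)) G
  have hup : ∀ p, H (upperPt p) = F p := by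
    rintro (t | t)
    · rfl
    · have := (h₃ t).2.2
      rw [hmid, hmid, Bool.xor_self] at this
      exact (bne_eq_false_iff_eq.1 this).symm
  have hH : ∀ u v, (glue a b) u v → ¬ (glue a b) (outerPt x) u → H u = H v := by
    intro u v huv
    induction huv with
    | rel _ _ h =>
      intro hu
      rcases h with h | h
      · rw [hup, hup]; exact h₁ _ _ h hu
      · exact h₂ _ _ h hu
    | refl _ => exact fun _ => rfl
    | symm _ _ h ih => exact fun hu => (ih fun h' => hu (.trans _ _ _ h' h)).symm
    | trans _ _ _ h h' ih ih' =>
      exact fun hu => (ih hu).trans (ih' fun h'' => hu (.trans _ _ _ h'' (.symm _ _ h)))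
  have hval : ∀ r, (CyclicDiagram.comp a b) x z → ¬ (CyclicDiagram.comp a b) x r →
      xor (decide (pos x < pos r)) (decide (pos z < pos r)) = H (outerPt r) := by
    intro r hxz hxr
    rw [outer_marks x r, outer_marks z r]
    · rcases r with r | r
      · exact (h₃ r).1.symm
      · simp only [Sum.elim_inr, Bool.not_xor_not]
        exact (h₃ r).2.1.symm
    · rintro rfl; exact hxr hxz
    · rintro rfl; exact hxr (Setoid.refl' _ _)
  rw [hval r hxz hxr, hval s hxz fun h => hxr (Setoid.trans' _ h (Setoid.symm' _ hrs))]
  exact hH _ _ hrs hxr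

end Planar

/-! ## Matchings -/

section Matching

/-- In a graph in which every vertex has at most one `α`-edge and at most one `β`-edge and which has
no isolated vertices, each end of a path has exactly one other end in its component. -/
theorem exists_unique_end {V : Type} [Finite V] (α β : V → V) (hα : ∀ v, α (α v) = v)
    (hβ : ∀ v, β (β v) = v) (hαβ : ∀ v, ¬ (α v = v ∧ β v = v)) (x : V) (hx : β x = x) :
    ∃! y, y ≠ x ∧ (α y = y ∨ β y = y) ∧
      Relation.EqvGen (fun u v => v = α u ∨ v = β u) x y := by
  let A : Equiv.Perm V := ⟨α, α, hα, hα⟩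
  let B : Equiv.Perm V := ⟨β, β, hβ, hβ⟩
  let ρ : Equiv.Perm V := A * B
  have hρ : B * ρ * B⁻¹ = ρ⁻¹ := by
    have hB : B⁻¹ = B := rfl
    have hA : A⁻¹ = A := rfl
    simp only [ρ, mul_inv_rev, hA, mul_assoc, mul_inv_cancel, mul_one]
    rw [hB]
  have hBk : ∀ k : ℤ, β ((ρ ^ k) x) = (ρ ^ (-k)) x := by
    intro k
    have h : B * ρ ^ k * B⁻¹ = ρ ^ (-k) := by rw [← conj_zpow, hρ, inv_zpow, zpow_neg]
    have h' : B⁻¹ x = x := hx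
    calc β ((ρ ^ k) x) = (B * ρ ^ k * B⁻¹) x := by rw [Equiv.Perm.mul_apply, h']; rfl
      _ = _ := by rw [h]
  have hAk : ∀ k : ℤ, α ((ρ ^ k) x) = (ρ ^ (1 - k)) x := by
    intro k
    have h : α ((ρ ^ k) x) = ρ (β ((ρ ^ k) x)) := by
      change _ = α (β (β ((ρ ^ k) x)))
      rw [hβ]
    rw [h, hBk, sub_eq_add_neg, zpow_add, zpow_one]; rfl
  have horb : ∀ y, Relation.EqvGen (fun u v => v = α u ∨ v = β u) x y → ∃ k : ℤ, y = (ρ ^ k) x := by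
    suffices h : ∀ u v, Relation.EqvGen (fun u v => v = α u ∨ v = β u) u v →
        ((∃ k : ℤ, u = (ρ ^ k) x) ↔ ∃ k : ℤ, v = (ρ ^ k) x) from
      fun y hy => (h x y hy).1 ⟨0, rfl⟩
    intro u v huv
    induction huv with
    | rel u v h =>
      rcases h with rfl | rfl
      · exact ⟨fun ⟨k, hk⟩ => ⟨1 - k, by rw [hk, hAk]⟩,
          fun ⟨k, hk⟩ => ⟨1 - k, by rw [← hAk, ← hk, hα]⟩⟩
      · exact ⟨fun ⟨k, hk⟩ => ⟨-k, by rw [hk, hBk]⟩, fun ⟨k, hk⟩ => ⟨-k, by rw [← hBk, ← hk, hβ]⟩⟩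
    | refl _ => exact Iff.rfl
    | symm _ _ _ ih => exact ih.symm
    | trans _ _ _ _ _ ih ih' => exact ih.trans ih'
  have hmem : ∀ k : ℤ, Relation.EqvGen (fun u v => v = α u ∨ v = β u) x ((ρ ^ k) x) := by
    have hstep : ∀ y, Relation.EqvGen (fun u v => v = α u ∨ v = β u) y (ρ y) := fun y =>
      .trans _ _ _ (.rel _ (β y) (.inr rfl)) (.rel _ _ (.inl rfl))
    intro k
    induction k with
    | zero => exact .refl _
    | succ k ih =>
      rw [add_comm, zpow_add, zpow_one]
      exact .trans _ _ _ ih (hstep _)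
    | pred k ih =>
      refine .trans _ _ _ ih (.symm _ _ ?_)
      have h : (ρ ^ (-(k : ℤ))) x = ρ ((ρ ^ (-(k : ℤ) - 1)) x) := by
        rw [← Equiv.Perm.mul_apply, ← zpow_one_add]; congr 2; omega
      rw [h]
      exact hstep _
  obtain ⟨N, hN, hper⟩ : ∃ N : ℕ, 0 < N ∧ ∀ k : ℤ, (ρ ^ k) x = x ↔ (N : ℤ) ∣ k := by
    refine ⟨Function.minimalPeriod (ρ • ·) x, ?_, fun k =>
      MulAction.zpow_smul_eq_iff_minimalPeriod_dvd (a := ρ) (b := x) (n := k)⟩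
    obtain ⟨m, hm, hm'⟩ := isOfFinOrder_iff_pow_eq_one.1 (isOfFinOrder_of_finite ρ)
    refine Function.IsPeriodicPt.minimalPeriod_pos hm ?_
    have h : (fun y => ρ • y) = ρ := rfl
    rw [h, Function.IsPeriodicPt, Function.IsFixedPt, ← Equiv.Perm.coe_pow, hm']; rfl
  have heq : ∀ k l : ℤ, (ρ ^ k) x = (ρ ^ l) x ↔ (N : ℤ) ∣ k - l := by
    intro k l
    rw [← hper, sub_eq_neg_add, zpow_add, Equiv.Perm.mul_apply, zpow_neg, Equiv.Perm.inv_eq_iff_eq,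
      eq_comm]
  have hend : ∀ k : ℤ, (α ((ρ ^ k) x) = (ρ ^ k) x ∨ β ((ρ ^ k) x) = (ρ ^ k) x) ↔
      ((N : ℤ) ∣ 2 * k - 1 ∨ (N : ℤ) ∣ 2 * k) := by
    intro k
    rw [hAk, hBk, heq, heq, ← dvd_neg, ← dvd_neg (b := -k - k)]
    ring_nf
  have hN1 : N ≠ 1 := by
    rintro rfl
    have h := (hper 1).2 (by simp)
    have h' : α (β x) = x := h
    rw [hx] at h'
    exact hαβ x ⟨h', hx⟩
  have hne : ∀ k : ℤ, (ρ ^ k) x ≠ x ↔ ¬ (N : ℤ) ∣ k := fun k => not_congr (hper k)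
  have main : ∀ k₀ : ℤ, ¬ (N : ℤ) ∣ k₀ → ((N : ℤ) ∣ 2 * k₀ - 1 ∨ (N : ℤ) ∣ 2 * k₀) →
      (∀ k : ℤ, ¬ (N : ℤ) ∣ k → ((N : ℤ) ∣ 2 * k - 1 ∨ (N : ℤ) ∣ 2 * k) → (N : ℤ) ∣ k - k₀) →
      ∃! y, y ≠ x ∧ (α y = y ∨ β y = y) ∧
        Relation.EqvGen (fun u v => v = α u ∨ v = β u) x y := by
    intro k₀ h₁ h₂ h₃
    refine ⟨(ρ ^ k₀) x, ⟨(hne _).2 h₁, (hend _).2 h₂, hmem _⟩, ?_⟩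
    rintro y ⟨hy₁, hy₂, hy₃⟩
    obtain ⟨k, rfl⟩ := horb y hy₃
    exact (heq _ _).2 (h₃ k ((hne _).1 hy₁) ((hend _).1 hy₂))
  rcases Nat.even_or_odd' N with ⟨M, rfl | rfl⟩
  · refine main M ?_ (.inr (by push_cast; exact dvd_rfl)) ?_
    · rintro ⟨t, ht⟩
      push_cast at ht
      have hM : (M : ℤ) ≠ 0 := by omega
      have : (1 : ℤ) = 2 * t := mul_left_cancel₀ hM (by linarith)
      omega
    · rintro k hk (⟨t, ht⟩ | ⟨t, ht⟩)
      · push_cast at ht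
        have : 2 * k - 1 = 2 * (M * t) := by linarith
        omega
      · push_cast at ht
        have h : k = M * t := by linarith
        rcases Int.even_or_odd' t with ⟨u, rfl | rfl⟩
        · exact (hk ⟨u, by push_cast; linarith⟩).elim
        · exact ⟨u, by push_cast; linarith⟩
  · have hcop : IsCoprime ((2 * M + 1 : ℕ) : ℤ) 2 := ⟨1, -M, by push_cast; ring⟩
    refine main (M + 1) ?_ (.inl ⟨1, by push_cast; ring⟩) ?_
    · rintro ⟨t, ht⟩
      push_cast at ht
      have hM : 0 < (M : ℤ) := by omega
      rcases le_or_gt t 0 with h | h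
      · nlinarith
      · nlinarith
    · rintro k hk (⟨t, ht⟩ | h)
      · refine hcop.dvd_of_dvd_mul_left ⟨t - 1, ?_⟩
        push_cast at ht ⊢
        linarith
      · exact (hk (hcop.dvd_of_dvd_mul_left h)).elim

/-- Stacking matchings gives a matching. -/
theorem IsMatching.comp {n : ℕ} {a b : Setoid (Fin n ⊕ Fin n)} (ha : IsMatching a)
    (hb : IsMatching b) : IsMatching (comp a b) := by
  choose f hf hf' using ha
  choose g hg hg' using hb
  have hff : ∀ p, f (f p) = p := fun p => (hf' _ _ ⟨(hf p).1.symm, a.symm (hf p).2⟩).symm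
  have hgg : ∀ p, g (g p) = p := fun p => (hg' _ _ ⟨(hg p).1.symm, b.symm (hg p).2⟩).symm
  let α : Fin n ⊕ Fin n ⊕ Fin n → Fin n ⊕ Fin n ⊕ Fin n
    | .inl x => upperPt (f (.inl x))
    | .inr (.inl y) => upperPt (f (.inr y))
    | .inr (.inr z) => .inr (.inr z)
  let β : Fin n ⊕ Fin n ⊕ Fin n → Fin n ⊕ Fin n ⊕ Fin n
    | .inl x => .inl x
    | .inr p => .inr (g p)
  have hup : ∀ p, α (upperPt p) = upperPt (f p) := by rintro (p | p) <;> rfl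
  have hupi : Function.Injective (upperPt : Fin n ⊕ Fin n → Fin n ⊕ Fin n ⊕ Fin n) :=
    Function.injective_id.sumMap Sum.inl_injective
  have hαα : ∀ v, α (α v) = v := by
    rintro (x | y | z)
    · change α (upperPt _) = _; rw [hup, hff]; rfl
    · change α (upperPt _) = _; rw [hup, hff]; rfl
    · rfl
  have hββ : ∀ v, β (β v) = v := by
    rintro (x | p)
    · rfl
    · exact congrArg Sum.inr (hgg p)
  have hαfix : ∀ v, α v = v ↔ ∃ z, v = .inr (.inr z) := by
    rintro (x | y | z)
    · refine ⟨fun h => ((hf (.inl x)).1 (hupi h)).elim, by simp⟩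
    · refine ⟨fun h => ((hf (.inr y)).1 (hupi h)).elim, by simp⟩
    · exact ⟨fun _ => ⟨z, rfl⟩, fun _ => rfl⟩
  have hβfix : ∀ v, β v = v ↔ ∃ z, v = .inl z := by
    rintro (x | p)
    · exact ⟨fun _ => ⟨x, rfl⟩, fun _ => rfl⟩
    · exact ⟨fun h => ((hg p).1 (Sum.inr_injective h)).elim, by simp⟩
  have hglue : ∀ u v, (glue a b) u v ↔ Relation.EqvGen (fun u v => v = α u ∨ v = β u) u v := by
    intro u v
    constructor <;> intro h
    · induction h with
      | rel _ _ h =>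
        rcases h with @⟨p, q, h⟩ | @⟨p, q, h⟩
        · by_cases hpq : q = p
          · subst hpq; exact .refl _
          · rw [hf' p q ⟨hpq, h⟩]
            exact .rel _ _ (.inl (hup p).symm)
        · by_cases hpq : q = p
          · subst hpq; exact .refl _
          · rw [hg' p q ⟨hpq, h⟩]
            exact .rel _ _ (.inr rfl)
      | refl _ => exact .refl _
      | symm _ _ _ ih => exact .symm _ _ ih
      | trans _ _ _ _ _ ih ih' => exact .trans _ _ _ ih ih'
    · induction h with
      | rel u v h =>
        rcases h with rfl | rfl
        · rcases u with x | y | z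
          · exact .rel _ _ (.upper (p := .inl x) (hf _).2)
          · exact .rel _ _ (.upper (p := .inr y) (hf _).2)
          · exact .refl _
        · rcases u with x | p
          · exact .refl _
          · exact .rel _ _ (.lower (hg _).2)
      | refl _ => exact .refl _
      | symm _ _ _ ih => exact .symm _ _ ih
      | trans _ _ _ _ _ ih ih' => exact .trans _ _ _ ih ih'
  have hαβ : ∀ v, ¬ (α v = v ∧ β v = v) := by
    rintro v ⟨h, h'⟩
    obtain ⟨z, rfl⟩ := (hαfix _).1 h
    obtain ⟨y, hy⟩ := (hβfix (.inr (.inr z))).1 h'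
    exact absurd hy (by simp)
  have houter : ∀ v, (α v = v ∨ β v = v) ↔ ∃ q, v = outerPt q := by
    intro v
    rw [hαfix, hβfix]
    constructor
    · rintro (⟨z, rfl⟩ | ⟨z, rfl⟩)
      · exact ⟨.inr z, rfl⟩
      · exact ⟨.inl z, rfl⟩
    · rintro ⟨z | z, rfl⟩
      · exact .inr ⟨z, rfl⟩
      · exact .inl ⟨z, rfl⟩
  have hout : Function.Injective (outerPt : Fin n ⊕ Fin n → Fin n ⊕ Fin n ⊕ Fin n) :=
    Function.injective_id.sumMap Sum.inr_injective
  have hend : ∀ p : Fin n ⊕ Fin n, ∃! y, y ≠ outerPt p ∧ (α y = y ∨ β y = y) ∧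
      Relation.EqvGen (fun u v => v = α u ∨ v = β u) (outerPt p) y := by
    rintro (x | z)
    · exact exists_unique_end α β hαα hββ hαβ _ rfl
    · have h := exists_unique_end β α hββ hαα (fun v h => hαβ v h.symm) (outerPt (.inr z)) rfl
      simpa only [or_comm] using h
  intro p
  obtain ⟨y, ⟨h₁, h₂, h₃⟩, h₄⟩ := hend p
  obtain ⟨q, rfl⟩ := (houter y).1 h₂
  refine ⟨q, ⟨fun h => h₁ (congrArg _ h), (hglue _ _).2 h₃⟩, ?_⟩
  rintro r ⟨hr, hr'⟩
  exact hout (h₄ _ ⟨fun h => hr (hout h), (houter _).2 ⟨r, rfl⟩, (hglue _ _).1 hr'⟩)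

end Matching

/-! ## The generating diagrams -/

section Generators

variable {n : ℕ}

/-- The partition with singleton blocks `{i}` and `{i'}` and blocks `{j, j'}` for `j ≠ i`. -/
def stopPart (n i : ℕ) : Setoid (Fin n ⊕ Fin n) :=
  Setoid.ker (Sum.elim
    (fun j : Fin n => if j.val + 1 = i then (Sum.inr true : Fin n ⊕ Bool) else Sum.inl j)
    (fun j : Fin n => if j.val + 1 = i then (Sum.inr false : Fin n ⊕ Bool) else Sum.inl j))

/-- The partition with the block `{i, i+1, i', (i+1)'}` and blocks `{j, j'}` for the other `j`. -/
def bridgePart (n i : ℕ) : Setoid (Fin n ⊕ Fin n) :=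
  Setoid.ker (Sum.elim
    (fun j : Fin n => if j.val + 1 = i ∨ j.val + 1 = i + 1 then (Sum.inr true : Fin n ⊕ Bool)
      else Sum.inl j)
    (fun j : Fin n => if j.val + 1 = i ∨ j.val + 1 = i + 1 then (Sum.inr true : Fin n ⊕ Bool)
      else Sum.inl j))

/-- The partition with blocks `{i, i+1}`, `{i', (i+1)'}` and `{j, j'}` for the other `j`. -/
def hookPart (n i : ℕ) : Setoid (Fin n ⊕ Fin n) :=
  Setoid.ker (Sum.elim
    (fun j : Fin n => if j.val + 1 = i ∨ j.val + 1 = i + 1 then (Sum.inr true : Fin n ⊕ Bool)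
      else Sum.inl j)
    (fun j : Fin n => if j.val + 1 = i ∨ j.val + 1 = i + 1 then (Sum.inr false : Fin n ⊕ Bool)
      else Sum.inl j))

theorem idPart_rel (p q : Fin n ⊕ Fin n) :
    (idPart (Fin n)) p q ↔ (p.elim id id).val = (q.elim id id).val := by
  rw [idPart, Setoid.ker_def]
  rcases p with p | p <;> rcases q with q | q <;> simp [Fin.ext_iff]

theorem stopPart_rel (i : ℕ) (p q : Fin n ⊕ Fin n) :
    (stopPart n i) p q ↔ (p.elim id id).val = (q.elim id id).val ∧
      (p.isLeft = q.isLeft ∨ (p.elim id id).val + 1 ≠ i) := by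
  rw [stopPart, Setoid.ker_def]
  rcases p with p | p <;> rcases q with q | q <;> simp only [Sum.elim_inl, Sum.elim_inr] <;>
    split_ifs <;> simp [Fin.ext_iff] <;> omega

theorem bridgePart_rel (i : ℕ) (p q : Fin n ⊕ Fin n) :
    (bridgePart n i) p q ↔ (p.elim id id).val = (q.elim id id).val ∨
      (((p.elim id id).val + 1 = i ∨ (p.elim id id).val = i) ∧
        ((q.elim id id).val + 1 = i ∨ (q.elim id id).val = i)) := by
  rw [bridgePart, Setoid.ker_def]
  rcases p with p | p <;> rcases q with q | q <;> simp only [Sum.elim_inl, Sum.elim_inr] <;>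
    split_ifs <;> simp [Fin.ext_iff] <;> omega

theorem hookPart_rel (i : ℕ) (p q : Fin n ⊕ Fin n) :
    (hookPart n i) p q ↔
      ((p.elim id id).val = (q.elim id id).val ∧ (p.elim id id).val + 1 ≠ i ∧
        (p.elim id id).val ≠ i) ∨
      (p.isLeft = q.isLeft ∧ ((p.elim id id).val + 1 = i ∨ (p.elim id id).val = i) ∧
        ((q.elim id id).val + 1 = i ∨ (q.elim id id).val = i)) := by
  rw [hookPart, Setoid.ker_def]
  rcases p with p | p <;> rcases q with q | q <;> simp only [Sum.elim_inl, Sum.elim_inr] <;>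
    split_ifs <;> simp [Fin.ext_iff] <;> omega

theorem idPart_planar (n : ℕ) : IsPlanar (idPart (Fin n)) := by
  intro p q r s
  simp only [idPart_rel]
  rcases p with p | p <;> rcases q with q | q <;> rcases r with r | r <;> rcases s with s | s <;>
    simp only [pos, Sum.elim_inl, Sum.elim_inr, id] <;> omega

theorem stopPart_planar (n i : ℕ) : IsPlanar (stopPart n i) := by
  intro p q r s
  simp only [stopPart_rel]
  rcases p with p | p <;> rcases q with q | q <;> rcases r with r | r <;> rcases s with s | s <;>
    simp [pos] <;> omega

theorem bridgePart_planar (n i : ℕ) : IsPlanar (bridgePart n i) := by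
  intro p q r s
  simp only [bridgePart_rel]
  rcases p with p | p <;> rcases q with q | q <;> rcases r with r | r <;> rcases s with s | s <;>
    simp only [pos, Sum.elim_inl, Sum.elim_inr, id] <;> omega

theorem hookPart_planar (n i : ℕ) : IsPlanar (hookPart n i) := by
  intro p q r s
  simp only [hookPart_rel]
  rcases p with p | p <;> rcases q with q | q <;> rcases r with r | r <;> rcases s with s | s <;>
    simp [pos] <;> omega

theorem idPart_matching (n : ℕ) : IsMatching (idPart (Fin n)) := by
  intro p
  refine ⟨p.swap, ⟨?_, ?_⟩, ?_⟩
  · rcases p with p | p <;> simp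
  · rw [idPart_rel]; rcases p with p | p <;> rfl
  · rintro q ⟨h, h'⟩
    rw [idPart_rel] at h'
    rcases p with p | p <;> rcases q with q | q <;> simp_all [Fin.ext_iff]

theorem hookPart_matching (n i : ℕ) (hi : 1 ≤ i ∧ i < n) : IsMatching (hookPart n i) := by
  intro p
  simp only [hookPart_rel]
  obtain ⟨k, rfl⟩ : ∃ k, i = k + 1 := ⟨i - 1, by omega⟩
  rcases p with p | p
  · by_cases h₁ : p.val = k
    · refine ⟨.inl ⟨k + 1, by omega⟩, ?_, ?_⟩
      · simp [Fin.ext_iff]; omega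
      · rintro (q | q) <;> simp [Fin.ext_iff] <;> omega
    · by_cases h₂ : p.val = k + 1
      · refine ⟨.inl ⟨k, by omega⟩, ?_, ?_⟩
        · simp [Fin.ext_iff]; omega
        · rintro (q | q) <;> simp [Fin.ext_iff] <;> omega
      · refine ⟨.inr p, ?_, ?_⟩
        · simp; omega
        · rintro (q | q) <;> simp [Fin.ext_iff] <;> omega
  · by_cases h₁ : p.val = k
    · refine ⟨.inr ⟨k + 1, by omega⟩, ?_, ?_⟩
      · simp [Fin.ext_iff]; omega
      · rintro (q | q) <;> simp [Fin.ext_iff] <;> omega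
    · by_cases h₂ : p.val = k + 1
      · refine ⟨.inr ⟨k, by omega⟩, ?_, ?_⟩
        · simp [Fin.ext_iff]; omega
        · rintro (q | q) <;> simp [Fin.ext_iff] <;> omega
      · refine ⟨.inl p, ?_, ?_⟩
        · simp; omega
        · rintro (q | q) <;> simp [Fin.ext_iff] <;> omega

end Generators

/-! ## The two monoids -/

/-- The `m`-cyclic planar partition monoid: planar partitions of the `2n` points, with internal
components counted modulo `m`. -/
noncomputable def PPa (m n : ℕ) : Submonoid (CyclicPartition m n) where
  carrier := {d | IsPlanar d.skeleton}
  mul_mem' := IsPlanar.comp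
  one_mem' := idPart_planar n

/-- The `m`-cyclic Temperley–Lieb monoid on `n` strands: crossingless matchings of the `2n` points,
with internal components counted modulo `m`. -/
noncomputable def TL (m n : ℕ) : Submonoid (CyclicPartition m n) where
  carrier := {d | IsPlanar d.skeleton ∧ IsMatching d.skeleton}
  mul_mem' h h' := ⟨h.1.comp h'.1, h.2.comp h'.2⟩
  one_mem' := ⟨idPart_planar n, idPart_matching n⟩

namespace PPa

/-- The identity diagram with one internal component. -/
def c (m n : ℕ) : PPa m n := ⟨⟨idPart (Fin n), 1⟩, idPart_planar n⟩

/-- The diagram `p_i`, for `1 ≤ i ≤ n`. -/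
def p (m n i : ℕ) : PPa m n := ⟨⟨stopPart n i, 0⟩, stopPart_planar n i⟩

/-- The diagram `p_{i+1/2}`, for `1 ≤ i < n`. -/
def pHalf (m n i : ℕ) : PPa m n := ⟨⟨bridgePart n i, 0⟩, bridgePart_planar n i⟩

end PPa

namespace TL

/-- The identity diagram with one internal component. -/
def o (m n : ℕ) : TL m n := ⟨⟨idPart (Fin n), 1⟩, idPart_planar n, idPart_matching n⟩

/-- The hook `u_i`, for `1 ≤ i < n`. -/
def u (m n i : ℕ) (hi : 1 ≤ i ∧ i < n) : TL m n :=
  ⟨⟨hookPart n i, 0⟩, hookPart_planar n i, hookPart_matching n i hi⟩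

end TL

end CyclicDiagram

/-!
A planar partition is doubled by passing to the boundary of a neighbourhood of its blocks: going
round the strip, the second copy of a point is joined to the first copy of the next point of its
block. Reading boundaries turns a partition `a` into the permutation `next a` whose cycles are the
blocks of `a`, and stacking diagrams into multiplying permutations of the three rows of points.

Everything then rests on Euler's formula for the stacked diagram. A list of transpositions has a
genus, which compares its length with the numbers of cycles of its product and of components of its
graph; the genus is nonnegative, and does not grow when transpositions are dropped. For planar `a`,
a shortest factorisation of `next a` extends to one of `next ⊤`, the cycle round the whole strip
(the extra factors form the Kreweras complement), and stacking two such cycles has genus zero. So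
every stack of planar diagrams has genus zero. Hence each component has a single outer boundary
walk, which makes doubling compatible with the product of diagrams, and the number of closed
boundary walks exceeds twice the number of internal components by a sum of block counts. The latter
is a coboundary, and adding `blocks a - n` to the doubled number of internal components absorbs it.
-/

namespace CyclicDiagram

open Equiv

section Blocks

variable {U : Type*}

/-- The number of blocks of a partition. -/
noncomputable def blocks (r : Setoid U) : ℕ := Nat.card (Quotient r)

/-- The partition obtained by joining the block of `s` and the block of `t`. -/
def joinBlocks (r : Setoid U) (s t : U) : Setoid U where
  r x y := r x y ∨ (r x s ∧ r t y) ∨ (r x t ∧ r s y)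
  iseqv := by
    refine ⟨fun x => .inl (r.refl x), ?_, ?_⟩
    · rintro x y (h | ⟨h, h'⟩ | ⟨h, h'⟩)
      · exact .inl (r.symm h)
      · exact .inr (.inr ⟨r.symm h', r.symm h⟩)
      · exact .inr (.inl ⟨r.symm h', r.symm h⟩)
    · rintro x y z (h | ⟨h, h'⟩ | ⟨h, h'⟩) (g | ⟨g, g'⟩ | ⟨g, g'⟩)
      · exact .inl (r.trans h g)
      · exact .inr (.inl ⟨r.trans h g, g'⟩)
      · exact .inr (.inr ⟨r.trans h g, g'⟩)
      · exact .inr (.inl ⟨h, r.trans h' g⟩)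
      · exact .inr (.inl ⟨h, g'⟩)
      · exact .inl (r.trans h g')
      · exact .inr (.inr ⟨h, r.trans h' g⟩)
      · exact .inl (r.trans h g')
      · exact .inr (.inr ⟨h, g'⟩)

theorem joinBlocks_apply (r : Setoid U) (s t x y : U) :
    joinBlocks r s t x y ↔ r x y ∨ (r x s ∧ r t y) ∨ (r x t ∧ r s y) := Iff.rfl

theorem le_joinBlocks (r : Setoid U) (s t : U) : r ≤ joinBlocks r s t := fun _ _ => .inl

theorem joinBlocks_pair (r : Setoid U) (s t : U) : joinBlocks r s t s t :=
  .inr (.inl ⟨r.refl s, r.refl t⟩)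

theorem joinBlocks_le_iff {r q : Setoid U} {s t : U} :
    joinBlocks r s t ≤ q ↔ r ≤ q ∧ q s t := by
  refine ⟨fun h => ⟨(le_joinBlocks r s t).trans h, h (joinBlocks_pair r s t)⟩, ?_⟩
  rintro ⟨h, hst⟩ x y (g | ⟨g, g'⟩ | ⟨g, g'⟩)
  · exact h g
  · exact q.trans (h g) (q.trans hst (h g'))
  · exact q.trans (h g) (q.trans (q.symm hst) (h g'))

theorem joinBlocks_of_rel {r : Setoid U} {s t : U} (h : r s t) : joinBlocks r s t = r :=
  le_antisymm (joinBlocks_le_iff.2 ⟨le_rfl, h⟩) (le_joinBlocks r s t)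

theorem blocks_antitone [Finite U] : Antitone (blocks (U := U)) := fun r q h =>
  Nat.card_le_card_of_surjective (Quotient.map' (s₁ := r) (s₂ := q) id fun _ _ g => h g)
    (Quotient.ind fun u => ⟨Quotient.mk r u, rfl⟩)

theorem blocks_pos [Finite U] (r : Setoid U) (u : U) : 0 < blocks r :=
  Nat.card_pos_iff.2 ⟨⟨Quotient.mk r u⟩, inferInstance⟩

theorem blocks_bot : blocks (⊥ : Setoid U) = Nat.card U :=
  (Nat.card_eq_of_bijective (Quotient.mk (⊥ : Setoid U))
    ⟨fun _ _ h => Quotient.exact h, Quotient.mk_surjective⟩).symm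

theorem blocks_le_card [Finite U] (r : Setoid U) : blocks r ≤ Nat.card U :=
  blocks_bot (U := U) ▸ blocks_antitone bot_le

theorem blocks_top_le_one [Finite U] : blocks (⊤ : Setoid U) ≤ 1 :=
  Finite.card_le_one_iff_subsingleton.2
    ⟨fun C D => Quotient.inductionOn₂ C D fun _ _ => Quotient.sound trivial⟩

theorem blocks_joinBlocks [Finite U] {r : Setoid U} {s t : U} (h : ¬ r s t) :
    blocks r = blocks (joinBlocks r s t) + 1 := by
  classical
  let project : {C : Quotient r // C ≠ Quotient.mk r s} → Quotient (joinBlocks r s t) := fun C =>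
    Quotient.map' (s₁ := r) (s₂ := joinBlocks r s t) id (fun _ _ g => le_joinBlocks r s t g) C.1
  have hproject : Function.Bijective project := by
    constructor
    · rintro ⟨⟨x⟩, hx⟩ ⟨⟨y⟩, hy⟩ hxy
      refine Subtype.ext (Quotient.sound ?_)
      rcases (Quotient.exact hxy : joinBlocks r s t x y) with g | ⟨g, -⟩ | ⟨-, g⟩
      · exact g
      · exact (hx (Quotient.sound g)).elim
      · exact (hy (Quotient.sound (r.symm g))).elim
    · rintro ⟨x⟩
      by_cases hx : r x s
      · exact ⟨⟨Quotient.mk r t, fun g => h (r.symm (Quotient.exact g))⟩,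
          Quotient.sound (.inr (.inr ⟨r.refl t, r.symm hx⟩))⟩
      · exact ⟨⟨Quotient.mk r x, fun g => hx (Quotient.exact g)⟩, rfl⟩
  rw [blocks, ← Nat.card_congr (optionSubtypeNe (Quotient.mk r s)), Finite.card_option,
    Nat.card_eq_of_bijective project hproject, blocks]

theorem blocks_le_joinBlocks_add_one [Finite U] (r : Setoid U) (s t : U) :
    blocks r ≤ blocks (joinBlocks r s t) + 1 := by
  by_cases h : r s t
  · rw [joinBlocks_of_rel h]
    omega
  · exact (blocks_joinBlocks h).le

end Blocks

section InnerBlocks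

variable {U V O P : Type*}

/-- The number of blocks that do not meet the range of `e`. For `e = outerPt` and the partition
`glue a b` this is `internalCount a b`. -/
noncomputable def innerBlocks (r : Setoid U) (e : O → U) : ℕ :=
  Nat.card {C : Quotient r // ∀ o, C ≠ Quotient.mk r (e o)}

/-- The blocks that meet the range of `e`, collapsed into one. -/
def collapse (r : Setoid U) (e : O → U) : Setoid U where
  r x y := r x y ∨ (∃ o, r x (e o)) ∧ ∃ o, r y (e o)
  iseqv := by
    refine ⟨fun x => .inl (r.refl x), fun h => h.imp r.symm And.symm, ?_⟩
    rintro x y z (h | ⟨hx, o, hy⟩) (g | ⟨⟨o', hy'⟩, hz⟩)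
    · exact .inl (r.trans h g)
    · exact .inr ⟨⟨o', r.trans h hy'⟩, hz⟩
    · exact .inr ⟨hx, o, r.trans (r.symm g) hy⟩
    · exact .inr ⟨hx, hz⟩

theorem blocks_eq_innerBlocks_add [Finite U] (r : Setoid U) (e : O → U) :
    blocks r = innerBlocks r e + blocks (r.comap e) := by
  classical
  let image : Quotient (r.comap e) → {C : Quotient r // ¬ ∀ o, C ≠ Quotient.mk r (e o)} :=
    Quotient.lift (fun o => ⟨Quotient.mk r (e o), fun h => h o rfl⟩)
      fun _ _ h => Subtype.ext (Quotient.sound h)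
  have himage : Function.Bijective image := by
    constructor
    · rintro ⟨o⟩ ⟨o'⟩ h
      exact Quotient.sound (Quotient.exact (congrArg Subtype.val h) : r (e o) (e o'))
    · rintro ⟨C, hC⟩
      push Not at hC
      obtain ⟨o, rfl⟩ := hC
      exact ⟨Quotient.mk _ o, rfl⟩
  rw [innerBlocks, blocks, blocks, Nat.card_eq_of_bijective image himage, ← Nat.card_sum]
  exact (Nat.card_congr (sumCompl _)).symm

theorem innerBlocks_congr {r q : Setoid U} {e : O → U} (h : r ≤ q) (h' : q ≤ collapse r e) :
    innerBlocks r e = innerBlocks q e := by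
  have outer_of_rel : ∀ {x o}, q x (e o) → ∃ o, r x (e o) := fun {x o} hx =>
    (h' hx).elim (fun g => ⟨o, g⟩) And.left
  refine Nat.card_eq_of_bijective (fun C : {C : Quotient r // ∀ o, C ≠ Quotient.mk r (e o)} =>
    ⟨Quotient.map' (s₁ := r) (s₂ := q) id (fun _ _ g => h g) C.1, ?_⟩) ⟨?_, ?_⟩
  · obtain ⟨⟨x⟩, hx⟩ := C
    intro o hxo
    obtain ⟨o', g⟩ := outer_of_rel (Quotient.exact hxo : q x (e o))
    exact hx o' (Quotient.sound g)
  · rintro ⟨⟨x⟩, hx⟩ ⟨⟨y⟩, hy⟩ hxy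
    have hxy : q x y := Quotient.exact (congrArg Subtype.val hxy)
    rcases h' hxy with g | ⟨⟨o, g⟩, -⟩
    · exact Subtype.ext (Quotient.sound g)
    · exact (hx o (Quotient.sound g)).elim
  · rintro ⟨⟨x⟩, hx⟩
    exact ⟨⟨Quotient.mk r x, fun o g => hx o (Quotient.sound (h (Quotient.exact g)))⟩, rfl⟩

theorem innerBlocks_comap (q : Setoid V) {f : U → V} (hf : f.Surjective) {e : O → U} {e' : P → V}
    (h : Set.range (f ∘ e) = Set.range e') :
    innerBlocks (q.comap f) e = innerBlocks q e' := by
  have houter : ∀ C : Quotient q, (∀ p, C ≠ Quotient.mk q (e' p)) ↔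
      ∀ o, C ≠ Quotient.mk q (f (e o)) := fun C => by
    have hC : (∀ v ∈ Set.range e', C ≠ Quotient.mk q v) ↔
        ∀ v ∈ Set.range (f ∘ e), C ≠ Quotient.mk q v := by rw [h]
    simpa only [Set.forall_mem_range, Function.comp_apply] using hC
  refine Nat.card_eq_of_bijective (fun C :
      {C : Quotient (q.comap f) // ∀ o, C ≠ Quotient.mk (q.comap f) (e o)} =>
    ⟨Quotient.map' (s₁ := q.comap f) (s₂ := q) f (fun _ _ g => g) C.1, ?_⟩) ⟨?_, ?_⟩
  · obtain ⟨⟨x⟩, hx⟩ := C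
    exact (houter _).2 fun o g => hx o (Quotient.sound (Quotient.exact g : q (f x) (f (e o))))
  · rintro ⟨⟨x⟩, hx⟩ ⟨⟨y⟩, hy⟩ hxy
    exact Subtype.ext (Quotient.sound
      (Quotient.exact (congrArg Subtype.val hxy) : q (f x) (f y)))
  · rintro ⟨⟨v⟩, hv⟩
    obtain ⟨x, rfl⟩ := hf v
    exact ⟨⟨Quotient.mk _ x, fun o g => (houter _).1 hv o
      (Quotient.sound (Quotient.exact g : (q.comap f) x (e o)))⟩, rfl⟩

end InnerBlocks

section Cycles

variable {U : Type*}

/-- The partition into the cycles of a permutation. -/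
abbrev cycles (π : Perm U) : Setoid U := Perm.SameCycle.setoid π

/-- The number of cycles, fixed points included. -/
noncomputable def cycleCount (π : Perm U) : ℕ := blocks (cycles π)

theorem cycles_apply_self (π : Perm U) (x : U) : cycles π x (π x) := ⟨1, by simp⟩

theorem cycles_le_iff {π : Perm U} {r : Setoid U} : cycles π ≤ r ↔ ∀ x, r x (π x) := by
  refine ⟨fun h x => h (cycles_apply_self π x), fun h x y => ?_⟩
  rintro ⟨k, rfl⟩
  induction k with
  | zero => exact r.refl x
  | succ k ih =>
    rw [add_comm, zpow_add, zpow_one]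
    exact r.trans ih (h _)
  | pred k ih =>
    refine r.trans ih (r.symm ?_)
    have := h ((π ^ (-(k : ℤ) - 1)) x)
    rwa [← Perm.mul_apply, ← zpow_one_add, add_sub_cancel] at this

theorem cycles_one : cycles (1 : Perm U) = ⊥ :=
  le_bot_iff.1 (cycles_le_iff.2 fun _ => rfl)

theorem mem_of_sameCycle [Finite U] {π : Perm U} {S : Set U} (hS : Set.MapsTo π S S) {x y : U}
    (h : π.SameCycle x y) (hx : x ∈ S) : y ∈ S := by
  obtain ⟨k, -, rfl⟩ := h.exists_pow_eq'
  rw [← Perm.iterate_eq_pow]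
  exact hS.iterate k hx

variable [DecidableEq U]

theorem cycles_swap_mul_le (π : Perm U) (s t : U) :
    cycles (swap s t * π) ≤ joinBlocks (cycles π) s t := by
  refine cycles_le_iff.2 fun x => ?_
  have hx := cycles_apply_self π x
  rw [Perm.mul_apply, swap_apply_def]
  split_ifs with hs ht
  · exact .inr (.inl ⟨hs ▸ hx, (cycles π).refl t⟩)
  · exact .inr (.inr ⟨ht ▸ hx, (cycles π).refl s⟩)
  · exact .inl hx

theorem cycles_le_swap_mul (π : Perm U) (s t : U) :
    cycles π ≤ joinBlocks (cycles (swap s t * π)) s t := by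
  simpa only [swap_mul_self_mul] using cycles_swap_mul_le (swap s t * π) s t

variable [Finite U]

theorem sameCycle_swap_mul {π : Perm U} {s t : U} (h : ¬ π.SameCycle s t) :
    (swap s t * π).SameCycle s t := by
  let S : Set U := {x | (swap s t * π).SameCycle s x ∧ π.SameCycle s x}
  have hS : Set.MapsTo π S S := by
    rintro x ⟨hx, hx'⟩
    have hπx : π.SameCycle s (π x) := hx'.trans (cycles_apply_self π x)
    refine ⟨?_, hπx⟩
    by_cases hs : π x = s
    · exact hs ▸ Perm.SameCycle.refl _ _
    · have hswap : (swap s t * π) x = π x :=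
        swap_apply_of_ne_of_ne hs fun ht => h (ht ▸ hπx)
      exact hswap ▸ hx.trans (cycles_apply_self _ x)
  have hmem : π⁻¹ s ∈ S :=
    mem_of_sameCycle hS (x := s) ⟨-1, by simp⟩ ⟨Perm.SameCycle.refl _ _, Perm.SameCycle.refl _ _⟩
  exact hmem.1.trans ⟨1, by simp⟩

theorem not_sameCycle_swap_mul {π : Perm U} {s t : U} (hst : s ≠ t) (h : π.SameCycle s t) :
    ¬ (swap s t * π).SameCycle s t := by
  obtain ⟨m, -, hm⟩ := h.exists_pow_eq'
  obtain ⟨k, hk, hmin⟩ := Nat.findX (⟨m, hm⟩ : ∃ k : ℕ, (π ^ k) s = t)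
  have hk₀ : 0 < k := Nat.pos_of_ne_zero fun h₀ => hst (by simpa [h₀] using hk)
  have hS : Set.MapsTo (swap s t * π) {x | ∃ j < k, (π ^ j) s = x}
      {x | ∃ j < k, (π ^ j) s = x} := by
    rintro _ ⟨j, hj, rfl⟩
    rw [Perm.mul_apply, ← Perm.mul_apply π, ← pow_succ']
    rcases Nat.lt_or_ge (j + 1) k with hj' | hj'
    · have hne : (π ^ (j + 1)) s ≠ s := fun hs => hmin (k - (j + 1)) (by omega) (by
        rwa [← Nat.sub_add_cancel hj'.le, pow_add, Perm.mul_apply, hs] at hk)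
      exact ⟨j + 1, hj', (swap_apply_of_ne_of_ne hne (hmin _ hj')).symm⟩
    · refine ⟨0, hk₀, ?_⟩
      rw [show j + 1 = k by omega, hk, swap_apply_right, pow_zero, Perm.one_apply]
  intro hs
  obtain ⟨j, hj, hjt⟩ := mem_of_sameCycle hS hs ⟨0, hk₀, rfl⟩
  exact hmin j hj hjt

theorem cycleCount_swap_mul_le (π : Perm U) (s t : U) :
    cycleCount (swap s t * π) ≤ cycleCount π + 1 :=
  (blocks_le_joinBlocks_add_one _ s t).trans
    (Nat.add_le_add_right (blocks_antitone (cycles_le_swap_mul π s t)) 1)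

theorem cycleCount_swap_mul_lt {π : Perm U} {s t : U} (h : ¬ π.SameCycle s t) :
    cycleCount (swap s t * π) < cycleCount π := by
  have hjoin : joinBlocks (cycles π) s t ≤ cycles (swap s t * π) := by
    have hst := sameCycle_swap_mul h
    refine joinBlocks_le_iff.2 ⟨(cycles_le_swap_mul π s t).trans ?_, hst⟩
    rw [joinBlocks_of_rel hst]
  rw [cycleCount, cycleCount, blocks_joinBlocks (r := cycles π) h]
  exact Nat.lt_succ_of_le (blocks_antitone hjoin)

theorem lt_cycleCount_swap_mul {π : Perm U} {s t : U} (hst : s ≠ t) (h : π.SameCycle s t) :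
    cycleCount π < cycleCount (swap s t * π) := by
  simpa only [swap_mul_self_mul] using cycleCount_swap_mul_lt (not_sameCycle_swap_mul hst h)

end Cycles

section Genus

variable {U : Type*}

/-- The finest partition in which the pairs of a list are related, that is, the partition into the
components of the graph whose edges are these pairs. -/
def connRel (l : List (U × U)) : Setoid U := Relation.EqvGen.setoid fun x y => (x, y) ∈ l

theorem connRel_le_iff {l : List (U × U)} {r : Setoid U} :
    connRel l ≤ r ↔ ∀ p ∈ l, r p.1 p.2 :=
  ⟨fun h _ hp => h (Relation.EqvGen.rel _ _ hp),
    fun h => Setoid.eqvGen_le fun x y hxy => h (x, y) hxy⟩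

theorem connRel_mono {l l' : List (U × U)} (h : l ⊆ l') : connRel l ≤ connRel l' :=
  connRel_le_iff.2 fun p hp => connRel_le_iff.1 le_rfl p (h hp)

theorem connRel_nil : connRel ([] : List (U × U)) = ⊥ :=
  le_bot_iff.1 (connRel_le_iff.2 fun _ hp => absurd hp List.not_mem_nil)

theorem connRel_append_cons (l l' : List (U × U)) (p : U × U) :
    connRel (l ++ p :: l') = joinBlocks (connRel (l ++ l')) p.1 p.2 := by
  refine eq_of_forall_ge_iff fun r => ?_
  simp only [joinBlocks_le_iff, connRel_le_iff, List.mem_append, List.mem_cons]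
  grind

theorem connRel_cons (p : U × U) (l : List (U × U)) :
    connRel (p :: l) = joinBlocks (connRel l) p.1 p.2 := connRel_append_cons [] l p

variable [DecidableEq U]

/-- The product of the transpositions of a list of pairs. -/
def swapProd (l : List (U × U)) : Perm U := (l.map fun p => swap p.1 p.2).prod

theorem swapProd_nil : swapProd ([] : List (U × U)) = 1 := rfl

theorem swapProd_cons (p : U × U) (l : List (U × U)) :
    swapProd (p :: l) = swap p.1 p.2 * swapProd l := by
  rw [swapProd, List.map_cons, List.prod_cons, swapProd]

theorem swapProd_append (l l' : List (U × U)) :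
    swapProd (l ++ l') = swapProd l * swapProd l' := by
  rw [swapProd, List.map_append, List.prod_append, swapProd, swapProd]

theorem swapProd_append_cons (l l' : List (U × U)) (p : U × U) : swapProd (l ++ p :: l') =
    swap (swapProd l p.1) (swapProd l p.2) * swapProd (l ++ l') := by
  rw [swapProd_append, swapProd_append, swapProd_cons, ← mul_assoc, ← mul_assoc,
    mul_swap_eq_swap_mul]

theorem cycles_swapProd_le (l : List (U × U)) : cycles (swapProd l) ≤ connRel l := by
  induction l with
  | nil => rw [swapProd_nil, cycles_one]; exact bot_le
  | cons p l ih =>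
    rw [swapProd_cons, connRel_cons]
    exact (cycles_swap_mul_le _ _ _).trans
      (joinBlocks_le_iff.2 ⟨ih.trans (le_joinBlocks _ _ _), joinBlocks_pair _ _ _⟩)

/-- Twice the genus, summed over components, of the surface glued from the cycles of a list of
transpositions and of its product. -/
noncomputable def doubleGenus (l : List (U × U)) : ℤ :=
  l.length + (Nat.card U - cycleCount (swapProd l)) - 2 * (Nat.card U - blocks (connRel l))

theorem doubleGenus_nil : doubleGenus ([] : List (U × U)) = 0 := by
  rw [doubleGenus, connRel_nil, swapProd_nil, cycleCount, cycles_one, blocks_bot]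
  simp

variable [Finite U]

theorem doubleGenus_le_append_cons (l l' : List (U × U)) (p : U × U) :
    doubleGenus (l ++ l') ≤ doubleGenus (l ++ p :: l') := by
  have hlen : (l ++ p :: l').length = (l ++ l').length + 1 := by
    simp only [List.length_append, List.length_cons]
    omega
  rw [doubleGenus, doubleGenus, swapProd_append_cons, connRel_append_cons, hlen]
  by_cases h : connRel (l ++ l') p.1 p.2
  · have hcycles :=
      cycleCount_swap_mul_le (swapProd (l ++ l')) (swapProd l p.1) (swapProd l p.2)
    rw [joinBlocks_of_rel h]
    omega
  · have hl : ∀ x, connRel (l ++ l') x (swapProd l x) := fun x =>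
      connRel_mono (List.subset_append_left l l')
        (cycles_swapProd_le l (cycles_apply_self _ x))
    have hcycles : ¬ (swapProd (l ++ l')).SameCycle (swapProd l p.1) (swapProd l p.2) := fun hs =>
      h (Setoid.trans' _ (hl _) (Setoid.trans' _ (cycles_swapProd_le _ hs)
        (Setoid.symm' _ (hl _))))
    have := cycleCount_swap_mul_lt hcycles
    have := blocks_joinBlocks h
    omega

theorem doubleGenus_mono {l l' : List (U × U)} (h : l.Sublist l') :
    doubleGenus l ≤ doubleGenus l' := by
  suffices H : ∀ k : List (U × U), doubleGenus (k ++ l) ≤ doubleGenus (k ++ l') from H []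
  induction h with
  | slnil => exact fun k => le_rfl
  | cons a _ ih => exact fun k => (ih k).trans (doubleGenus_le_append_cons k _ a)
  | cons_cons a _ ih => exact fun k => by simpa using ih (k ++ [a])

theorem doubleGenus_nonneg (l : List (U × U)) : 0 ≤ doubleGenus l :=
  doubleGenus_nil (U := U) ▸ doubleGenus_mono (List.nil_sublist l)

theorem doubleGenus_cons_eq {l : List (U × U)} {s t : U} (hst : s ≠ t)
    (h : (swapProd l).SameCycle s t) : doubleGenus ((s, t) :: l) = doubleGenus l := by
  have hlt := lt_cycleCount_swap_mul hst h
  have hle := cycleCount_swap_mul_le (swapProd l) s t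
  rw [doubleGenus, doubleGenus, swapProd_cons, connRel_cons,
    joinBlocks_of_rel (cycles_swapProd_le l h), List.length_cons]
  push_cast
  omega

-- Prepending the transposition of `s` and `t` keeps the genus of `l'` zero, hence that of `l`,
-- where it would grow if `s` and `t` were in different cycles.
theorem sameCycle_of_sublist {l l' : List (U × U)} (hl : l.Sublist l') (hg : doubleGenus l' = 0)
    {s t : U} (h : connRel l s t) (h' : (swapProd l').SameCycle s t) :
    (swapProd l).SameCycle s t := by
  rcases eq_or_ne s t with rfl | hst
  · exact Perm.SameCycle.refl _ _
  by_contra hs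
  have hlt := cycleCount_swap_mul_lt hs
  have hle := doubleGenus_mono (hl.cons_cons (s, t))
  have hnonneg := doubleGenus_nonneg l
  rw [doubleGenus_cons_eq hst h', hg, doubleGenus, swapProd_cons, connRel_cons,
    joinBlocks_of_rel h, List.length_cons] at hle
  rw [doubleGenus] at hnonneg
  push_cast at hle
  omega

theorem exists_swapProd_eq (π : Perm U) :
    ∃ l : List (U × U), swapProd l = π ∧ connRel l = cycles π ∧
      l.length + cycleCount π = Nat.card U := by
  induction hk : Nat.card U - cycleCount π using Nat.strong_induction_on generalizing π with
  | _ k ih =>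
  by_cases hπ : π = 1
  · subst hπ
    exact ⟨[], rfl, connRel_nil.trans cycles_one.symm, by
      rw [cycleCount, cycles_one, blocks_bot, List.length_nil, zero_add]⟩
  obtain ⟨s, hs⟩ : ∃ s, π s ≠ s := by
    by_contra! h
    exact hπ (Perm.ext h)
  have hrel := cycles_apply_self π s
  have hlt := lt_cycleCount_swap_mul hs.symm hrel
  have hle : cycleCount (swap s (π s) * π) ≤ Nat.card U := blocks_le_card _
  obtain ⟨l, hprod, hconn, hlen⟩ := ih _ (by omega) (swap s (π s) * π) rfl
  refine ⟨(s, π s) :: l, by rw [swapProd_cons, hprod, swap_mul_self_mul], ?_, ?_⟩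
  · rw [connRel_cons, hconn]
    refine le_antisymm (joinBlocks_le_iff.2 ⟨?_, hrel⟩) (cycles_le_swap_mul π _ _)
    exact (cycles_swap_mul_le π _ _).trans (joinBlocks_of_rel (r := cycles π) hrel).le
  · have := cycleCount_swap_mul_le π s (π s)
    rw [List.length_cons]
    omega

end Genus

section Next

variable {n : ℕ}

theorem pos_ne {p q : Fin n ⊕ Fin n} (h : p ≠ q) : pos p ≠ pos q := pos_injective.ne h

theorem pos_nonneg (p : Fin n ⊕ Fin n) : 0 ≤ pos p := by
  rcases p with p | p <;> have := p.2 <;> simp only [pos] <;> omega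

theorem pos_lt (p : Fin n ⊕ Fin n) : pos p < 2 * n := by
  rcases p with p | p <;> have := p.2 <;> simp only [pos] <;> omega

theorem exists_pos_eq {k : ℤ} (h : 0 ≤ k) (h' : k < 2 * n) : ∃ p : Fin n ⊕ Fin n, pos p = k := by
  rcases lt_or_ge k n with hk | hk
  · exact ⟨.inl ⟨k.toNat, by omega⟩, by simp only [pos]; omega⟩
  · exact ⟨.inr ⟨(2 * n - 1 - k).toNat, by omega⟩, by simp only [pos]; omega⟩

/-- The point `z` lies strictly between `x` and `y`, going around the strip from `x` to `y`; for
`x = y` this means that `z ≠ x`. -/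
def Arc (x y z : Fin n ⊕ Fin n) : Prop :=
  (pos x < pos z ∧ pos z < pos y) ∨ (pos y ≤ pos x ∧ (pos x < pos z ∨ pos z < pos y))

theorem IsPlanar.arc {a : Setoid (Fin n ⊕ Fin n)} (ha : IsPlanar a) {x y z w : Fin n ⊕ Fin n}
    (hxy : a x y) (hzw : a z w) (hxz : ¬ a x z) (h : Arc x y z) : Arc x y w := by
  have hyz : ¬ a y z := fun g => hxz (a.trans hxy g)
  have hxw : ¬ a x w := fun g => hxz (a.trans g (a.symm hzw))
  have hyw : ¬ a y w := fun g => hxw (a.trans hxy g)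
  have hpos := pos_ne fun g : x = w => hxw (g ▸ a.refl x)
  have hpos' := pos_ne fun g : y = w => hyw (g ▸ a.refl y)
  have not_cross : ∀ {p q r s}, a p r → a q s → ¬ a p q →
      ¬ (pos p < pos q ∧ pos q < pos r ∧ pos r < pos s) :=
    fun hpr hqs hpq g => hpq (ha _ _ _ _ g.1 g.2.1 g.2.2 hpr hqs)
  have hyx := a.symm hxy
  have hwz := a.symm hzw
  have h₁ := not_cross hxy hzw hxz
  have h₂ := not_cross hyx hwz hyw
  have h₃ := not_cross hzw hyx fun g => hyz (a.symm g)
  have h₄ := not_cross hwz hxy fun g => hxw (a.symm g)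
  clear not_cross
  rcases h with h | ⟨h, h | h⟩
  · left; omega
  · right; omega
  · right; omega

/-- The point `y` is the next point of the block of `x`, going around the strip. -/
def IsNext (a : Setoid (Fin n ⊕ Fin n)) (x y : Fin n ⊕ Fin n) : Prop :=
  a x y ∧ ∀ z, Arc x y z → ¬ a x z

theorem exists_isNext (a : Setoid (Fin n ⊕ Fin n)) (x : Fin n ⊕ Fin n) : ∃ y, IsNext a x y := by
  by_cases h : ∃ z, a x z ∧ pos x < pos z
  · obtain ⟨y, ⟨hy, hxy⟩, hmin⟩ := Set.exists_min_image {z | a x z ∧ pos x < pos z} pos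
      (Set.toFinite _) h
    refine ⟨y, hy, fun z hz hxz => ?_⟩
    have hyz : pos x < pos z → pos y ≤ pos z := fun g => hmin z ⟨hxz, g⟩
    rw [Arc] at hz
    omega
  · push Not at h
    obtain ⟨y, hy, hmin⟩ := Set.exists_min_image {z | a x z} pos (Set.toFinite _) ⟨x, a.refl x⟩
    refine ⟨y, hy, fun z hz hxz => ?_⟩
    have hyz := hmin z hxz
    have hzx := h z hxz
    rw [Arc] at hz
    omega

theorem IsNext.unique {a : Setoid (Fin n ⊕ Fin n)} {x y y' : Fin n ⊕ Fin n} (h : IsNext a x y)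
    (h' : IsNext a x y') : y = y' := by
  by_contra hne
  have hpos := pos_ne hne
  have hy' : ¬ Arc x y y' := fun g => h.2 y' g h'.1
  have hy : ¬ Arc x y' y := fun g => h'.2 y g h.1
  rw [Arc] at hy hy'
  omega

theorem IsNext.injective {a : Setoid (Fin n ⊕ Fin n)} {x x' y : Fin n ⊕ Fin n} (h : IsNext a x y)
    (h' : IsNext a x' y) : x = x' := by
  by_contra hne
  have hpos := pos_ne hne
  have hxx' := a.trans h.1 (a.symm h'.1)
  have hx' : ¬ Arc x y x' := fun g => h.2 x' g hxx'
  have hx : ¬ Arc x' y x := fun g => h'.2 x g (a.symm hxx')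
  rw [Arc] at hx hx'
  omega

/-- The permutation that sends a point to the next point of its block, going around the strip. -/
noncomputable def next (a : Setoid (Fin n ⊕ Fin n)) : Perm (Fin n ⊕ Fin n) :=
  Equiv.ofBijective (fun x => (exists_isNext a x).choose) <|
    Finite.injective_iff_bijective.1 fun x x' h =>
      (exists_isNext a x).choose_spec.injective
        ((show (exists_isNext a x).choose = _ from h) ▸ (exists_isNext a x').choose_spec)

theorem next_isNext (a : Setoid (Fin n ⊕ Fin n)) (x : Fin n ⊕ Fin n) : IsNext a x (next a x) :=
  (exists_isNext a x).choose_spec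

theorem next_rel (a : Setoid (Fin n ⊕ Fin n)) (x : Fin n ⊕ Fin n) : a x (next a x) :=
  (next_isNext a x).1

theorem next_eq_iff {a : Setoid (Fin n ⊕ Fin n)} {x y : Fin n ⊕ Fin n} :
    next a x = y ↔ IsNext a x y :=
  ⟨fun h => h ▸ next_isNext a x, fun h => (next_isNext a x).unique h⟩

theorem cycles_next (a : Setoid (Fin n ⊕ Fin n)) : cycles (next a) = a := by
  refine le_antisymm (cycles_le_iff.2 (next_rel a)) ?_
  have of_le : ∀ k : ℕ, ∀ x y, a x y → pos x ≤ pos y → (pos y - pos x).toNat = k →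
      cycles (next a) x y := by
    intro k
    induction k using Nat.strong_induction_on with
    | _ k ih =>
    intro x y hxy hle hk
    rcases eq_or_ne x y with rfl | hne
    · exact (cycles (next a)).refl x
    · have hpos := pos_ne hne
      have hy : ¬ Arc x (next a x) y := fun g => (next_isNext a x).2 y g hxy
      rw [Arc] at hy
      exact (cycles (next a)).trans (cycles_apply_self _ x) (ih _ (by omega) _ y
        (a.trans (a.symm (next_rel a x)) hxy) (by omega) rfl)
  intro x y hxy
  rcases le_total (pos x) (pos y) with h | h
  · exact of_le _ x y hxy h rfl
  · exact (cycles (next a)).symm (of_le _ y x (a.symm hxy) h rfl)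

theorem next_injective : Function.Injective (next (n := n)) := fun a b h => by
  rw [← cycles_next a, h, cycles_next]

theorem pos_lt_adjacent {a : Setoid (Fin n ⊕ Fin n)} {s t x : Fin n ⊕ Fin n}
    (hst : pos t = pos s + 1) (hs : ¬ a x s) (ht : ¬ a x t) :
    decide (pos x < pos s) = decide (pos x < pos t) ∧
      decide (pos s < pos x) = decide (pos t < pos x) := by
  have := pos_ne fun h : x = s => hs (h ▸ a.refl x)
  have := pos_ne fun h : x = t => ht (h ▸ a.refl x)
  constructor <;> rw [decide_eq_decide] <;> omega

theorem IsPlanar.parity_joinBlocks_adjacent {a : Setoid (Fin n ⊕ Fin n)} (ha : IsPlanar a)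
    {s t x z r r' : Fin n ⊕ Fin n} (hst : pos t = pos s + 1) (hxz : a x z)
    (hr : joinBlocks a s t r r') (hxr : ¬ joinBlocks a s t x r) :
    xor (decide (pos x < pos r)) (decide (pos z < pos r)) =
      xor (decide (pos x < pos r')) (decide (pos z < pos r')) := by
  have not_rel : ∀ {y}, joinBlocks a s t r y → ¬ a x y ∧ ¬ a z y := fun {y} hy =>
    have hxy : ¬ a x y := fun g => hxr (Setoid.trans' _ (.inl g) (Setoid.symm' _ hy))
    ⟨hxy, fun g => hxy (a.trans hxz g)⟩
  rcases hr with g | ⟨g, g'⟩ | ⟨g, g'⟩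
  · exact ha.parity hxz g (not_rel (.inl (a.refl r))).1
  · obtain ⟨hxs, hzs⟩ := not_rel (.inl g)
    obtain ⟨hxt, hzt⟩ := not_rel (.inr (.inl ⟨g, a.refl t⟩))
    rw [ha.parity hxz g fun h => hxs (a.trans h g), (pos_lt_adjacent hst hxs hxt).1,
      (pos_lt_adjacent hst hzs hzt).1, ha.parity hxz g' hxt]
  · obtain ⟨hxt, hzt⟩ := not_rel (.inl g)
    obtain ⟨hxs, hzs⟩ := not_rel (.inr (.inr ⟨g, a.refl s⟩))
    rw [ha.parity hxz g fun h => hxt (a.trans h g), ← (pos_lt_adjacent hst hxs hxt).1,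
      ← (pos_lt_adjacent hst hzs hzt).1, ha.parity hxz g' hxs]

theorem IsPlanar.joinBlocks_adjacent {a : Setoid (Fin n ⊕ Fin n)} (ha : IsPlanar a)
    {s t : Fin n ⊕ Fin n} (hst : pos t = pos s + 1) : IsPlanar (joinBlocks a s t) := by
  refine isPlanar_of_parity fun x z r r' hxz hr hxr => ?_
  have of_mem : joinBlocks a s t x s → joinBlocks a s t x t → ∀ {y}, joinBlocks a s t r y →
      decide (pos s < pos y) = decide (pos t < pos y) := fun hs ht {y} hy =>
    have not_rel : ∀ {u}, joinBlocks a s t x u → ¬ a y u := fun hu g =>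
      hxr (Setoid.trans' _ hu (Setoid.symm' _ (Setoid.trans' _ hy (.inl g))))
    (pos_lt_adjacent hst (not_rel hs) (not_rel ht)).2
  rcases hxz with g | ⟨g, g'⟩ | ⟨g, g'⟩
  · exact ha.parity_joinBlocks_adjacent hst g hr hxr
  · have hxs : joinBlocks a s t x s := .inl g
    have hxt : joinBlocks a s t x t := .inr (.inl ⟨g, a.refl t⟩)
    have hs := ha.parity_joinBlocks_adjacent hst g hr hxr
    have ht := ha.parity_joinBlocks_adjacent hst g' hr fun h => hxr (Setoid.trans' _ hxt h)
    have hr₀ := of_mem hxs hxt (Setoid.refl' _ r)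
    have hr₁ := of_mem hxs hxt hr
    grind
  · have hxt : joinBlocks a s t x t := .inl g
    have hxs : joinBlocks a s t x s := .inr (.inr ⟨g, a.refl s⟩)
    have ht := ha.parity_joinBlocks_adjacent hst g hr hxr
    have hs := ha.parity_joinBlocks_adjacent hst g' hr fun h => hxr (Setoid.trans' _ hxs h)
    have hr₀ := of_mem hxs hxt (Setoid.refl' _ r)
    have hr₁ := of_mem hxs hxt hr
    grind

theorem IsPlanar.isNext_joinBlocks_of_next_eq {a : Setoid (Fin n ⊕ Fin n)} (ha : IsPlanar a)
    {s t : Fin n ⊕ Fin n} (hst : pos t = pos s + 1) (hne : ¬ a s t) {x : Fin n ⊕ Fin n}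
    (hxt : next a x = t) : IsNext (joinBlocks a s t) x (next a s) := by
  have hs := next_isNext a s
  have hx : IsNext a x t := hxt ▸ next_isNext a x
  have hxs : ¬ a x s := fun g => hne (a.trans (a.symm g) hx.1)
  refine ⟨.inr (.inr ⟨hx.1, hs.1⟩), ?_⟩
  have harc : Arc s (next a s) t → Arc s (next a s) x := ha.arc hs.1 (a.symm hx.1) hne
  have hpos := pos_ne fun g : next a s = t => hne (g ▸ hs.1)
  rintro z hz (g | ⟨g, -⟩ | ⟨-, g⟩)
  · have hxz : ¬ Arc x t z := fun h => hx.2 z h g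
    simp only [Arc] at harc hxz hz
    omega
  · exact hxs g
  · have hsz : ¬ Arc s (next a s) z := fun h => hs.2 z h g
    simp only [Arc] at harc hsz hz
    omega

theorem IsPlanar.isNext_joinBlocks_of_next_ne {a : Setoid (Fin n ⊕ Fin n)} (ha : IsPlanar a)
    {s t : Fin n ⊕ Fin n} (hst : pos t = pos s + 1) (hne : ¬ a s t) {x : Fin n ⊕ Fin n}
    (hxs : x ≠ s) (hxt : next a x ≠ t) : IsNext (joinBlocks a s t) x (next a x) := by
  have hx := next_isNext a x
  have hpos := pos_ne hxs
  have hpos' := pos_ne hxt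
  refine ⟨.inl hx.1, ?_⟩
  rintro z hz (g | ⟨g, g'⟩ | ⟨g, g'⟩)
  · exact hx.2 z hz g
  · have hxs' : ¬ Arc x (next a x) s := fun h => hx.2 s h g
    have hxt' : Arc x (next a x) t := ha.arc hx.1 (a.symm g')
      (fun h => hne (a.trans (a.symm g) (a.trans h (a.symm g')))) hz
    simp only [Arc] at hxs' hxt'
    omega
  · have hxt' : ¬ Arc x (next a x) t := fun h => hx.2 t h g
    have hxs' : Arc x (next a x) s := ha.arc hx.1 (a.symm g')
      (fun h => hne (a.trans g' (a.trans (a.symm h) g))) hz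
    simp only [Arc] at hxs' hxt'
    omega

theorem IsPlanar.next_joinBlocks_adjacent {a : Setoid (Fin n ⊕ Fin n)} (ha : IsPlanar a)
    {s t : Fin n ⊕ Fin n} (hst : pos t = pos s + 1) (hne : ¬ a s t) :
    next (joinBlocks a s t) = swap (next a s) t * next a := by
  refine Perm.ext fun x => next_eq_iff.2 ?_
  rw [Perm.mul_apply]
  rcases eq_or_ne x s with rfl | hxs
  · rw [swap_apply_left]
    refine ⟨joinBlocks_pair a x t, fun z hz => ?_⟩
    rw [Arc] at hz
    omega
  · rw [swap_apply_def, if_neg fun h => hxs ((next a).injective h)]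
    split_ifs with hxt
    · exact ha.isNext_joinBlocks_of_next_eq hst hne hxt
    · exact ha.isNext_joinBlocks_of_next_ne hst hne hxs hxt

theorem eq_top_of_rel_adjacent {a : Setoid (Fin n ⊕ Fin n)}
    (h : ∀ s t, pos t = pos s + 1 → a s t) : a = ⊤ := by
  have of_add : ∀ k : ℕ, ∀ x y, pos y = pos x + k → a x y := by
    intro k
    induction k with
    | zero =>
      intro x y hxy
      rw [pos_injective (show pos x = pos y by omega)]
    | succ k ih =>
      intro x y hxy
      have := pos_nonneg x
      have := pos_lt y
      obtain ⟨z, hz⟩ := exists_pos_eq (n := n) (k := pos x + k) (by omega) (by omega)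
      exact a.trans (ih x z hz) (h z y (by omega))
  refine top_le_iff.1 fun x y _ => ?_
  rcases le_total (pos x) (pos y) with hxy | hxy
  · exact of_add (pos y - pos x).toNat x y (by omega)
  · exact a.symm (of_add (pos x - pos y).toNat y x (by omega))

/-- The list is a factorisation of the Kreweras complement of `a`. -/
theorem IsPlanar.exists_complement {a : Setoid (Fin n ⊕ Fin n)} (ha : IsPlanar a) :
    ∃ l : List ((Fin n ⊕ Fin n) × (Fin n ⊕ Fin n)),
      swapProd l * next a = next ⊤ ∧ l.length ≤ blocks a - 1 := by
  induction hk : blocks a using Nat.strong_induction_on generalizing a with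
  | _ k ih =>
  by_cases h : ∀ s t, pos t = pos s + 1 → a s t
  · exact ⟨[], by rw [eq_top_of_rel_adjacent h, swapProd_nil, one_mul], Nat.zero_le _⟩
  · push Not at h
    obtain ⟨s, t, hst, hne⟩ := h
    have hblocks := blocks_joinBlocks hne
    have hpos := blocks_pos (joinBlocks a s t) s
    obtain ⟨l, hprod, hlen⟩ := ih _ (by omega) (ha.joinBlocks_adjacent hst) rfl
    refine ⟨l ++ [(next a s, t)], ?_, ?_⟩
    · rw [← hprod, ha.next_joinBlocks_adjacent hst hne, swapProd_append, mul_assoc, swapProd_cons,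
        swapProd_nil, mul_one]
    · rw [List.length_append, List.length_singleton]
      omega

end Next

section Doubled

variable {n : ℕ}

/-- The first of the two points that replace a point when the strip is doubled, in the order going
around the strip. -/
def minusPt : Fin n ⊕ Fin n → Fin (2 * n) ⊕ Fin (2 * n) :=
  Sum.map (fun i => ⟨2 * i, by omega⟩) (fun i => ⟨2 * i + 1, by omega⟩)

/-- The second of the two points that replace a point when the strip is doubled. -/
def plusPt : Fin n ⊕ Fin n → Fin (2 * n) ⊕ Fin (2 * n) :=
  Sum.map (fun i => ⟨2 * i + 1, by omega⟩) (fun i => ⟨2 * i, by omega⟩)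

theorem pos_minusPt (x : Fin n ⊕ Fin n) : pos (minusPt x) = 2 * pos x := by
  rcases x with x | x <;> simp only [minusPt, pos, Sum.map_inl, Sum.map_inr] <;> push_cast <;> ring

theorem pos_plusPt (x : Fin n ⊕ Fin n) : pos (plusPt x) = 2 * pos x + 1 := by
  rcases x with x | x <;> simp only [plusPt, pos, Sum.map_inl, Sum.map_inr] <;> push_cast <;> ring

theorem bijective_doublePts :
    Function.Bijective (Sum.elim (minusPt (n := n)) (plusPt (n := n))) := by
  constructor
  · rintro (x | x) (y | y) h <;> have h := congrArg pos h <;>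
      simp only [Sum.elim_inl, Sum.elim_inr, pos_minusPt, pos_plusPt] at h
    · rw [pos_injective (show pos x = pos y by omega)]
    · omega
    · omega
    · rw [pos_injective (show pos x = pos y by omega)]
  · intro q
    have := pos_nonneg q
    have := pos_lt q
    obtain ⟨x, hx⟩ := exists_pos_eq (n := n) (k := pos q / 2) (by omega) (by omega)
    rcases Int.emod_two_eq_zero_or_one (pos q) with h | h
    · exact ⟨.inl x, pos_injective (by rw [Sum.elim_inl, pos_minusPt]; omega)⟩
    · exact ⟨.inr x, pos_injective (by rw [Sum.elim_inr, pos_plusPt]; omega)⟩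

/-- The points of the doubled strip are two copies of the points of the strip. -/
noncomputable def doublePts :
    (Fin n ⊕ Fin n) ⊕ (Fin n ⊕ Fin n) ≃ Fin (2 * n) ⊕ Fin (2 * n) :=
  .ofBijective _ bijective_doublePts

theorem doublePts_symm_minusPt (x : Fin n ⊕ Fin n) : doublePts.symm (minusPt x) = .inl x :=
  doublePts.symm_apply_apply (.inl x)

theorem doublePts_symm_plusPt (x : Fin n ⊕ Fin n) : doublePts.symm (plusPt x) = .inr x :=
  doublePts.symm_apply_apply (.inr x)

theorem eq_minusPt_or_plusPt (q : Fin (2 * n) ⊕ Fin (2 * n)) :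
    ∃ x : Fin n ⊕ Fin n, q = minusPt x ∨ q = plusPt x := by
  obtain ⟨x | x, rfl⟩ := doublePts.surjective q
  · exact ⟨x, .inl rfl⟩
  · exact ⟨x, .inr rfl⟩

theorem plusPt_injective : Function.Injective (plusPt (n := n)) :=
  bijective_doublePts.1.comp Sum.inr_injective

theorem minusPt_ne_plusPt (x y : Fin n ⊕ Fin n) : minusPt x ≠ plusPt y :=
  bijective_doublePts.1.ne (a₁ := .inl x) (a₂ := .inr y) Sum.inl_ne_inr

theorem arc_plus_minus_plus {x y z : Fin n ⊕ Fin n} :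
    Arc (plusPt x) (minusPt y) (plusPt z) ↔ Arc x y z := by
  simp only [Arc, pos_plusPt, pos_minusPt]
  omega

theorem arc_plus_minus_minus {x y z : Fin n ⊕ Fin n} :
    Arc (plusPt x) (minusPt y) (minusPt z) ↔ Arc x y z := by
  simp only [Arc, pos_plusPt, pos_minusPt]
  omega

/-- The matching of the doubled strip that joins the second copy of `x` to the first copy of
`π x`. -/
noncomputable def pairing (π : Perm (Fin n ⊕ Fin n)) : Setoid (Fin (2 * n) ⊕ Fin (2 * n)) :=
  Setoid.ker (Sum.elim id π ∘ doublePts.symm)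

theorem pairing_minus_minus (π : Perm (Fin n ⊕ Fin n)) (x y : Fin n ⊕ Fin n) :
    pairing π (minusPt x) (minusPt y) ↔ x = y := by
  rw [pairing, Setoid.ker_def, Function.comp_apply, Function.comp_apply, doublePts_symm_minusPt,
    doublePts_symm_minusPt, Sum.elim_inl, Sum.elim_inl, id_eq, id_eq]

theorem pairing_plus_plus (π : Perm (Fin n ⊕ Fin n)) (x y : Fin n ⊕ Fin n) :
    pairing π (plusPt x) (plusPt y) ↔ x = y := by
  rw [pairing, Setoid.ker_def, Function.comp_apply, Function.comp_apply, doublePts_symm_plusPt,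
    doublePts_symm_plusPt, Sum.elim_inr, Sum.elim_inr, π.injective.eq_iff]

theorem pairing_plus_minus (π : Perm (Fin n ⊕ Fin n)) (x y : Fin n ⊕ Fin n) :
    pairing π (plusPt x) (minusPt y) ↔ π x = y := by
  rw [pairing, Setoid.ker_def, Function.comp_apply, Function.comp_apply, doublePts_symm_plusPt,
    doublePts_symm_minusPt, Sum.elim_inr, Sum.elim_inl, id_eq]

theorem pairing_minus_plus (π : Perm (Fin n ⊕ Fin n)) (x y : Fin n ⊕ Fin n) :
    pairing π (minusPt x) (plusPt y) ↔ π y = x :=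
  (Setoid.comm' _).trans (pairing_plus_minus π y x)

theorem pairing_apply (π : Perm (Fin n ⊕ Fin n)) (x : Fin n ⊕ Fin n) :
    pairing π (plusPt x) (minusPt (π x)) := (pairing_plus_minus π _ _).2 rfl

theorem pairing_injective : Function.Injective (pairing (n := n)) := fun π π' h =>
  Perm.ext fun x => ((pairing_plus_minus π' x (π x)).1 (h ▸ pairing_apply π x)).symm

theorem pairing_cases {π : Perm (Fin n ⊕ Fin n)} {p q : Fin (2 * n) ⊕ Fin (2 * n)}
    (h : pairing π p q) : p = q ∨ ∃ x, (p = plusPt x ∧ q = minusPt (π x)) ∨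
      (p = minusPt (π x) ∧ q = plusPt x) := by
  obtain ⟨x, rfl | rfl⟩ := eq_minusPt_or_plusPt p <;>
    obtain ⟨y, rfl | rfl⟩ := eq_minusPt_or_plusPt q
  · exact .inl (congrArg _ ((pairing_minus_minus π x y).1 h))
  · exact .inr ⟨y, .inr ⟨congrArg _ ((pairing_minus_plus π x y).1 h).symm, rfl⟩⟩
  · exact .inr ⟨x, .inl ⟨rfl, congrArg _ ((pairing_plus_minus π x y).1 h).symm⟩⟩
  · exact .inl (congrArg _ ((pairing_plus_plus π x y).1 h))

theorem pairing_le_iff {π : Perm (Fin n ⊕ Fin n)} {r : Setoid (Fin (2 * n) ⊕ Fin (2 * n))} :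
    pairing π ≤ r ↔ ∀ x, r (plusPt x) (minusPt (π x)) := by
  refine ⟨fun h x => h (pairing_apply π x), fun h p q hpq => ?_⟩
  rcases pairing_cases hpq with rfl | ⟨x, ⟨rfl, rfl⟩ | ⟨rfl, rfl⟩⟩
  · exact r.refl p
  · exact h x
  · exact r.symm (h x)

theorem pairing_isMatching (π : Perm (Fin n ⊕ Fin n)) : IsMatching (pairing π) := by
  intro p
  obtain ⟨x, rfl | rfl⟩ := eq_minusPt_or_plusPt p
  · refine ⟨plusPt (π.symm x), ⟨(minusPt_ne_plusPt _ _).symm,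
      (pairing_minus_plus π _ _).2 (π.apply_symm_apply x)⟩, ?_⟩
    rintro q ⟨hq, h⟩
    obtain ⟨y, rfl | rfl⟩ := eq_minusPt_or_plusPt q
    · exact (hq (congrArg _ ((pairing_minus_minus π x y).1 h).symm)).elim
    · rw [← (pairing_minus_plus π x y).1 h, π.symm_apply_apply]
  · refine ⟨minusPt (π x), ⟨minusPt_ne_plusPt _ _, pairing_apply π x⟩, ?_⟩
    rintro q ⟨hq, h⟩
    obtain ⟨y, rfl | rfl⟩ := eq_minusPt_or_plusPt q
    · rw [(pairing_plus_minus π x y).1 h]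
    · exact (hq (congrArg _ ((pairing_plus_plus π x y).1 h).symm)).elim

theorem IsMatching.eq_of_le {r q : Setoid (Fin n ⊕ Fin n)} (hr : IsMatching r)
    (hq : IsMatching q) (h : r ≤ q) : r = q := by
  refine le_antisymm h fun x y hxy => ?_
  obtain ⟨z, ⟨hz, hxz⟩, -⟩ := hr x
  by_cases hyx : y = x
  · rw [hyx]
  · rwa [(hq x).unique ⟨hyx, hxy⟩ ⟨hz, h hxz⟩]

theorem IsPlanar.arc_next {a : Setoid (Fin n ⊕ Fin n)} (ha : IsPlanar a) (x w : Fin n ⊕ Fin n) :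
    Arc x (next a x) w ↔ Arc x (next a x) (next a w) := by
  by_cases h : a x w
  · exact iff_of_false (fun g => (next_isNext a x).2 w g h)
      fun g => (next_isNext a x).2 _ g (a.trans h (next_rel a w))
  · exact ⟨ha.arc (next_rel a x) (next_rel a w) h,
      ha.arc (next_rel a x) (a.symm (next_rel a w)) fun g => h (a.trans g (a.symm (next_rel a w)))⟩

theorem IsPlanar.pairing_next {a : Setoid (Fin n ⊕ Fin n)} (ha : IsPlanar a) :
    IsPlanar (pairing (next a)) := by
  intro p q r s hpq hqr hrs hpr hqs
  exfalso
  rcases pairing_cases hpr with rfl | ⟨x, hx⟩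
  · omega
  rcases pairing_cases hqs with rfl | ⟨w, hw⟩
  · omega
  have harc := ha.arc_next x w
  simp only [Arc] at harc
  rcases hx with ⟨rfl, rfl⟩ | ⟨rfl, rfl⟩ <;> rcases hw with ⟨rfl, rfl⟩ | ⟨rfl, rfl⟩ <;>
    simp only [pos_minusPt, pos_plusPt] at hpq hqr hrs <;> omega

end Doubled

section MapPairs

variable {P U : Type*} (e : P ↪ U)

/-- The image of a list of pairs under an embedding. -/
def mapPairs (l : List (P × P)) : List (U × U) := l.map (Prod.map e e)

theorem connRel_mapPairs_le_iff {e : P ↪ U} {l : List (P × P)} {r : Setoid U} :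
    connRel (mapPairs e l) ≤ r ↔ connRel l ≤ r.comap e := by
  rw [connRel_le_iff, connRel_le_iff, mapPairs, List.forall_mem_map]
  rfl

variable [DecidableEq P] [DecidableEq U]

theorem viaEmbedding_swap (s t : P) : (swap s t).viaEmbedding e = swap (e s) (e t) := by
  ext x
  by_cases hx : x ∈ Set.range e
  · obtain ⟨p, rfl⟩ := hx
    rw [Perm.viaEmbedding_apply, e.swap_apply]
  · rw [Perm.viaEmbedding_apply_of_notMem _ _ _ hx, swap_apply_of_ne_of_ne]
    · rintro rfl; exact hx ⟨s, rfl⟩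
    · rintro rfl; exact hx ⟨t, rfl⟩

theorem swapProd_mapPairs (l : List (P × P)) :
    swapProd (mapPairs e l) = (swapProd l).viaEmbedding e := by
  induction l with
  | nil => exact (map_one (Perm.viaEmbeddingHom e)).symm
  | cons p l ih =>
    rw [mapPairs, List.map_cons, ← mapPairs, swapProd_cons, swapProd_cons, ih, Prod.map_fst,
      Prod.map_snd, ← viaEmbedding_swap]
    exact (map_mul (Perm.viaEmbeddingHom e) _ _).symm

end MapPairs

section Stack

variable {n : ℕ}

/-- The embedding of the upper diagram into the stacked diagram. -/
def upperEmb : Fin n ⊕ Fin n ↪ Fin n ⊕ Fin n ⊕ Fin n :=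
  ⟨upperPt, Function.injective_id.sumMap Sum.inl_injective⟩

/-- The embedding of the lower diagram into the stacked diagram. -/
def lowerEmb : Fin n ⊕ Fin n ↪ Fin n ⊕ Fin n ⊕ Fin n := ⟨Sum.inr, Sum.inr_injective⟩

/-- The permutation of the three rows that follows `π` in the upper diagram and then `ρ` in the
lower one. -/
noncomputable def stack (π ρ : Perm (Fin n ⊕ Fin n)) : Perm (Fin n ⊕ Fin n ⊕ Fin n) :=
  ρ.viaEmbedding lowerEmb * π.viaEmbedding upperEmb

theorem viaEmbedding_upperPt (π : Perm (Fin n ⊕ Fin n)) (p : Fin n ⊕ Fin n) :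
    π.viaEmbedding upperEmb (upperPt p) = upperPt (π p) :=
  Perm.viaEmbedding_apply π upperEmb p

theorem viaEmbedding_lowerPt (π : Perm (Fin n ⊕ Fin n)) (p : Fin n ⊕ Fin n) :
    π.viaEmbedding lowerEmb (.inr p) = .inr (π p) :=
  Perm.viaEmbedding_apply π lowerEmb p

theorem viaEmbedding_lowerEmb_top (π : Perm (Fin n ⊕ Fin n)) (x : Fin n) :
    π.viaEmbedding lowerEmb (.inl x) = .inl x :=
  Perm.viaEmbedding_apply_of_notMem _ _ _ fun ⟨_, h⟩ => Sum.inr_ne_inl h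

theorem stack_upperPt_of_inl {π ρ : Perm (Fin n ⊕ Fin n)} {p : Fin n ⊕ Fin n} {x : Fin n}
    (h : π p = .inl x) : stack π ρ (upperPt p) = .inl x := by
  rw [stack, Perm.mul_apply, viaEmbedding_upperPt, h]
  exact viaEmbedding_lowerEmb_top ρ x

theorem stack_upperPt_of_inr {π ρ : Perm (Fin n ⊕ Fin n)} {p : Fin n ⊕ Fin n} {y : Fin n}
    (h : π p = .inr y) : stack π ρ (upperPt p) = .inr (ρ (.inl y)) := by
  rw [stack, Perm.mul_apply, viaEmbedding_upperPt, h]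
  exact viaEmbedding_lowerPt ρ (.inl y)

theorem stack_bottom (π ρ : Perm (Fin n ⊕ Fin n)) (z : Fin n) :
    stack π ρ (.inr (.inr z)) = .inr (ρ (.inr z)) := by
  have hz : π.viaEmbedding upperEmb (.inr (.inr z)) = .inr (.inr z) := by
    refine Perm.viaEmbedding_apply_of_notMem _ _ _ ?_
    rintro ⟨x | y, h⟩
    · exact Sum.inl_ne_inr h
    · exact Sum.inl_ne_inr (Sum.inr_injective h)
  rw [stack, Perm.mul_apply, hz]
  exact viaEmbedding_lowerPt ρ (.inr z)

/-- The pairs of two lists, placed in the upper and in the lower part of the stacked diagram. -/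
def stackPairs (l l' : List ((Fin n ⊕ Fin n) × (Fin n ⊕ Fin n))) :
    List ((Fin n ⊕ Fin n ⊕ Fin n) × (Fin n ⊕ Fin n ⊕ Fin n)) :=
  mapPairs lowerEmb l' ++ mapPairs upperEmb l

theorem length_stackPairs (l l' : List ((Fin n ⊕ Fin n) × (Fin n ⊕ Fin n))) :
    (stackPairs l l').length = l'.length + l.length := by
  rw [stackPairs, List.length_append, mapPairs, mapPairs, List.length_map, List.length_map]

theorem swapProd_stackPairs (l l' : List ((Fin n ⊕ Fin n) × (Fin n ⊕ Fin n))) :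
    swapProd (stackPairs l l') = stack (swapProd l) (swapProd l') := by
  rw [stackPairs, swapProd_append, swapProd_mapPairs, swapProd_mapPairs, stack]

theorem glue_le_iff {a b : Setoid (Fin n ⊕ Fin n)} {r : Setoid (Fin n ⊕ Fin n ⊕ Fin n)} :
    glue a b ≤ r ↔ a ≤ r.comap upperEmb ∧ b ≤ r.comap lowerEmb := by
  refine ⟨fun h => ⟨fun p q g => h (.rel _ _ (.upper g)), fun p q g => h (.rel _ _ (.lower g))⟩,
    fun h => Setoid.eqvGen_le ?_⟩
  rintro _ _ (g | g)
  · exact h.1 g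
  · exact h.2 g

theorem connRel_stackPairs (l l' : List ((Fin n ⊕ Fin n) × (Fin n ⊕ Fin n))) :
    connRel (stackPairs l l') = glue (connRel l) (connRel l') := by
  refine eq_of_forall_ge_iff fun r => ?_
  rw [glue_le_iff, ← connRel_mapPairs_le_iff, ← connRel_mapPairs_le_iff, connRel_le_iff,
    connRel_le_iff, connRel_le_iff, stackPairs, List.forall_mem_append, and_comm]

theorem cycles_stack_le (a b : Setoid (Fin n ⊕ Fin n)) :
    cycles (stack (next a) (next b)) ≤ glue a b := by
  obtain ⟨l, hprod, hconn, -⟩ := exists_swapProd_eq (next a)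
  obtain ⟨l', hprod', hconn', -⟩ := exists_swapProd_eq (next b)
  rw [cycles_next] at hconn hconn'
  have := cycles_swapProd_le (stackPairs l l')
  rwa [swapProd_stackPairs, connRel_stackPairs, hprod, hprod', hconn, hconn'] at this

theorem next_top {p q : Fin n ⊕ Fin n}
    (h : pos q = pos p + 1 ∨ (pos p = 2 * n - 1 ∧ pos q = 0)) : next ⊤ p = q := by
  refine next_eq_iff.2 ⟨trivial, fun z hz => ?_⟩
  have := pos_nonneg z
  have := pos_lt z
  rw [Arc] at hz
  omega

theorem stack_top_middle {i : Fin n} (hi : 0 < i.val) :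
    stack (next ⊤) (next ⊤) (.inr (.inl i)) = .inr (.inl i) := by
  let j : Fin n := ⟨i - 1, by omega⟩
  have hij : next ⊤ (.inr i : Fin n ⊕ Fin n) = .inr j :=
    next_top (.inl (by simp only [pos, j]; omega))
  have hji : next ⊤ (.inl j : Fin n ⊕ Fin n) = .inl i :=
    next_top (.inl (by simp only [pos, j]; omega))
  exact (stack_upperPt_of_inr hij).trans (congrArg Sum.inr hji)

theorem le_cycleCount_stack_top : n ≤ cycleCount (stack (next (n := n) ⊤) (next ⊤)) := by
  have eq_of_pos : ∀ i j : Fin n, 0 < i.val →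
      (stack (next ⊤) (next ⊤)).SameCycle (.inr (.inl i)) (.inr (.inl j)) → i = j := by
    intro i j hi h
    exact Sum.inl_injective (Sum.inr_injective (h.eq_of_left (stack_top_middle hi)))
  let middleCycle : Fin n → Quotient (cycles (stack (next (n := n) ⊤) (next ⊤))) := fun i =>
    Quotient.mk _ (.inr (.inl i))
  have hinj : middleCycle.Injective := by
    intro i j h
    by_cases hi : 0 < i.val
    · exact eq_of_pos i j hi (Quotient.exact h)
    · by_cases hj : 0 < j.val
      · exact (eq_of_pos j i hj (Quotient.exact h.symm)).symm
      · exact Fin.ext (by omega)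
  have := Nat.card_le_card_of_injective middleCycle hinj
  rwa [Nat.card_fin] at this

theorem stack_top_outerPt {p q : Fin n ⊕ Fin n} (h : pos q = pos p + 1) :
    stack (next ⊤) (next ⊤) (outerPt p) = outerPt q := by
  have hpq : next ⊤ p = q := next_top (.inl h)
  rcases p with i | i <;> rcases q with j | j
  · exact stack_upperPt_of_inl (p := .inl i) hpq
  · obtain rfl : i = j := by
      simp only [pos] at h
      omega
    exact (stack_upperPt_of_inr (p := .inl i) hpq).trans (congrArg Sum.inr hpq)
  · simp only [pos] at h
    omega
  · exact (stack_bottom _ _ i).trans (congrArg Sum.inr hpq)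

theorem sameCycle_stack_top (p q : Fin n ⊕ Fin n) :
    (stack (next ⊤) (next ⊤)).SameCycle (outerPt p) (outerPt q) := by
  have htop : (cycles (stack (next (n := n) ⊤) (next ⊤))).comap outerPt = ⊤ :=
    eq_top_of_rel_adjacent fun s t hst => by
      rw [Setoid.comap_rel, ← stack_top_outerPt hst]
      exact cycles_apply_self _ _
  exact Setoid.eq_top_iff.1 htop p q

theorem glue_top : glue (⊤ : Setoid (Fin n ⊕ Fin n)) (⊤ : Setoid (Fin n ⊕ Fin n)) = ⊤ := by
  have middle : ∀ (u : Fin n ⊕ Fin n ⊕ Fin n) (i : Fin n), glue ⊤ ⊤ u (.inr (.inl i))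
    | .inl x, i => .rel _ _ (.upper (p := .inl x) (q := .inr i) trivial)
    | .inr y, i => .rel _ _ (.lower (p := y) (q := .inl i) trivial)
  refine Setoid.eq_top_iff.2 fun u v => ?_
  let i : Fin n := u.elim id (Sum.elim id id)
  exact Setoid.trans' _ (middle u i) (Setoid.symm' _ (middle v i))

theorem card_threeRows : Nat.card (Fin n ⊕ Fin n ⊕ Fin n) = 3 * n := by
  rw [Nat.card_sum, Nat.card_sum, Nat.card_fin]
  ring

theorem doubleGenus_stackPairs_top {l l' : List ((Fin n ⊕ Fin n) × (Fin n ⊕ Fin n))}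
    (h : swapProd l = next ⊤) (h' : swapProd l' = next ⊤) (hl : l.length ≤ 2 * n - 1)
    (hl' : l'.length ≤ 2 * n - 1) : doubleGenus (stackPairs l l') = 0 := by
  have connRel_eq_top : ∀ {k : List ((Fin n ⊕ Fin n) × (Fin n ⊕ Fin n))},
      swapProd k = next ⊤ → connRel k = ⊤ := fun {k} hk =>
    top_le_iff.1 (cycles_next (n := n) ⊤ ▸ hk ▸ cycles_swapProd_le k)
  have hnonneg := doubleGenus_nonneg (stackPairs l l')
  have hcount := le_cycleCount_stack_top (n := n)
  have hblocks := blocks_top_le_one (U := Fin n ⊕ Fin n ⊕ Fin n)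
  have hblocks' := blocks_le_card (⊤ : Setoid (Fin n ⊕ Fin n ⊕ Fin n))
  rw [doubleGenus, swapProd_stackPairs, connRel_stackPairs, h, h', connRel_eq_top h,
    connRel_eq_top h', glue_top, length_stackPairs, card_threeRows] at hnonneg ⊢
  rw [card_threeRows] at hblocks'
  push_cast at hnonneg ⊢
  omega

theorem IsPlanar.exists_sublist {a : Setoid (Fin n ⊕ Fin n)} (ha : IsPlanar a) :
    ∃ l k : List ((Fin n ⊕ Fin n) × (Fin n ⊕ Fin n)), l.Sublist k ∧ swapProd l = next a ∧
      connRel l = a ∧ l.length + blocks a = 2 * n ∧ swapProd k = next ⊤ ∧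
      k.length ≤ 2 * n - 1 := by
  obtain ⟨l, hprod, hconn, hlen⟩ := exists_swapProd_eq (next a)
  obtain ⟨k, hk, hlen'⟩ := ha.exists_complement
  rw [cycleCount, cycles_next, Nat.card_sum, Nat.card_fin, ← two_mul] at hlen
  refine ⟨l, k ++ l, List.sublist_append_right k l, hprod, hconn.trans (cycles_next a), hlen,
    by rw [swapProd_append, hprod, hk], ?_⟩
  have hpos : 0 < n → 0 < blocks a := fun h => blocks_pos a (.inl ⟨0, h⟩)
  rw [List.length_append]
  omega

theorem IsPlanar.exists_stackPairs {a b : Setoid (Fin n ⊕ Fin n)} (ha : IsPlanar a)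
    (hb : IsPlanar b) : ∃ l k : List ((Fin n ⊕ Fin n ⊕ Fin n) × (Fin n ⊕ Fin n ⊕ Fin n)),
      l.Sublist k ∧ swapProd l = stack (next a) (next b) ∧ connRel l = glue a b ∧
      l.length + blocks a + blocks b = 4 * n ∧ swapProd k = stack (next ⊤) (next ⊤) ∧
      doubleGenus k = 0 := by
  obtain ⟨l, k, hsub, hprod, hconn, hlen, htop, hk⟩ := ha.exists_sublist
  obtain ⟨l', k', hsub', hprod', hconn', hlen', htop', hk'⟩ := hb.exists_sublist
  refine ⟨stackPairs l l', stackPairs k k', (hsub'.map _).append (hsub.map _), ?_, ?_, ?_, ?_,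
    doubleGenus_stackPairs_top htop htop' hk hk'⟩
  · rw [swapProd_stackPairs, hprod, hprod']
  · rw [connRel_stackPairs, hconn, hconn']
  · rw [length_stackPairs]
    omega
  · rw [swapProd_stackPairs, htop, htop']

theorem IsPlanar.comap_cycles_stack {a b : Setoid (Fin n ⊕ Fin n)} (ha : IsPlanar a)
    (hb : IsPlanar b) : (cycles (stack (next a) (next b))).comap outerPt =
      CyclicDiagram.comp a b := by
  obtain ⟨l, k, hsub, hprod, hconn, -, htop, hgenus⟩ := ha.exists_stackPairs hb
  refine le_antisymm (fun p q h => cycles_stack_le a b h) fun p q h => ?_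
  rw [Setoid.comap_rel, ← hprod]
  exact sameCycle_of_sublist hsub hgenus (hconn ▸ h) (htop ▸ sameCycle_stack_top p q)

theorem IsPlanar.euler {a b : Setoid (Fin n ⊕ Fin n)} (ha : IsPlanar a) (hb : IsPlanar b) :
    (n : ℤ) + 2 * blocks (glue a b) =
      blocks a + blocks b + cycleCount (stack (next a) (next b)) := by
  obtain ⟨l, k, hsub, hprod, hconn, hlen, -, hgenus⟩ := ha.exists_stackPairs hb
  have hle := doubleGenus_mono hsub
  have hnonneg := doubleGenus_nonneg l
  rw [hgenus] at hle
  rw [doubleGenus, hprod, hconn, card_threeRows] at hle hnonneg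
  push_cast at hle hnonneg
  omega

end Stack

section FirstReturn

variable {O U : Type*} {σ : Perm U} {e : O → U}

/-- Iterating `σ` from `u`, at least once, the first point of the range of `e` that is met is
`e o`. -/
inductive Reaches (σ : Perm U) (e : O → U) : U → O → Prop
  | here {u : U} {o : O} : σ u = e o → Reaches σ e u o
  | step {u : U} {o : O} : σ u ∉ Set.range e → Reaches σ e (σ u) o → Reaches σ e u o

theorem exists_reaches [Finite U] (σ : Perm U) (e : O → U) (o : O) :
    ∃ o', Reaches σ e (e o) o' := by
  by_contra! h
  have hS : Set.MapsTo σ {u | ∀ o', ¬ Reaches σ e u o'} {u | ∀ o', ¬ Reaches σ e u o'} := by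
    intro u hu o' hσu
    by_cases hσ : σ u ∈ Set.range e
    · obtain ⟨o'', hσ⟩ := hσ
      exact hu o'' (.here hσ.symm)
    · exact hu o' (.step hσ hσu)
  exact mem_of_sameCycle hS (y := σ⁻¹ (e o)) ⟨-1, by simp⟩ h o (.here (by simp))

theorem Reaches.sameCycle {u : U} {o : O} (h : Reaches σ e u o) : σ.SameCycle u (e o) := by
  induction h with
  | here h => exact h ▸ cycles_apply_self σ _
  | step _ _ ih => exact Perm.SameCycle.trans (cycles_apply_self σ _) ih

theorem mem_of_sameCycle_of_reaches [Finite U] (he : e.Injective) {S : Set O}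
    (hS : ∀ o ∈ S, ∀ o', Reaches σ e (e o) o' → o' ∈ S) {o o' : O} (h : σ.SameCycle (e o) (e o'))
    (ho : o ∈ S) : o' ∈ S := by
  let T : Set U := {u | (∀ o, Reaches σ e u o → o ∈ S) ∧ ∀ o, e o = u → o ∈ S}
  have hT : Set.MapsTo σ T T := by
    rintro u ⟨hu, -⟩
    by_cases hσ : σ u ∈ Set.range e
    · obtain ⟨v, hv⟩ := hσ
      have hvS := hu v (.here hv.symm)
      exact ⟨fun w hw => hS v hvS w (hv ▸ hw), fun w hw => he (hw.trans hv.symm) ▸ hvS⟩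
    · exact ⟨fun w hw => hu w (.step hσ hw), fun w hw => (hσ ⟨w, hw⟩).elim⟩
  exact (mem_of_sameCycle hT h ⟨hS o ho, fun w hw => he hw ▸ ho⟩).2 o' rfl

end FirstReturn

section Walk

variable {n : ℕ}

/-- The point of the doubled stacked diagram at which the boundary walk leaves `u`. The two copies
of a point of the middle row lie in both diagrams, and the walk passes the first copy only. -/
def startPt : Fin n ⊕ Fin n ⊕ Fin n → Fin (2 * n) ⊕ Fin (2 * n) ⊕ Fin (2 * n)
  | .inl x => upperPt (plusPt (.inl x))
  | .inr (.inl y) => .inr (minusPt (.inl y))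
  | .inr (.inr z) => .inr (plusPt (.inr z))

/-- The point of the doubled stacked diagram at which the boundary walk reaches `u`. -/
def endPt : Fin n ⊕ Fin n ⊕ Fin n → Fin (2 * n) ⊕ Fin (2 * n) ⊕ Fin (2 * n)
  | .inl x => upperPt (minusPt (.inl x))
  | .inr p => .inr (minusPt p)

theorem startPt_outerPt (p : Fin n ⊕ Fin n) : startPt (outerPt p) = outerPt (plusPt p) := by
  rcases p with p | p <;> rfl

theorem endPt_outerPt (p : Fin n ⊕ Fin n) : endPt (outerPt p) = outerPt (minusPt p) := by
  rcases p with p | p <;> rfl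

theorem startPt_upperPt (p : Fin n ⊕ Fin n) : startPt (upperPt p) = upperPt (plusPt p) := by
  rcases p with p | p <;> rfl

theorem startPt_eq_endPt_or (u : Fin n ⊕ Fin n ⊕ Fin n) :
    startPt u = endPt u ∨ ∃ p, u = outerPt p := by
  rcases u with x | y | z
  · exact .inr ⟨.inl x, rfl⟩
  · exact .inl rfl
  · exact .inr ⟨.inr z, rfl⟩

theorem glue_pairing_upper (π ρ : Perm (Fin n ⊕ Fin n)) (q : Fin n ⊕ Fin n) :
    glue (pairing π) (pairing ρ) (upperPt (minusPt q))
      (endPt (ρ.viaEmbedding lowerEmb (upperPt q))) := by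
  rcases q with x | y
  · rw [show upperPt (.inl x : Fin n ⊕ Fin n) = .inl x from rfl, viaEmbedding_lowerEmb_top]
    exact Setoid.refl' _ _
  · rw [show upperPt (.inr y : Fin n ⊕ Fin n) = .inr (.inl y) from rfl, viaEmbedding_lowerPt]
    exact .rel _ _ (.lower (pairing_apply ρ (.inl y)))

theorem glue_pairing_walk (π ρ : Perm (Fin n ⊕ Fin n)) (u : Fin n ⊕ Fin n ⊕ Fin n) :
    glue (pairing π) (pairing ρ) (startPt u) (endPt (stack π ρ u)) := by
  have from_upper : ∀ p, glue (pairing π) (pairing ρ) (startPt (upperPt p))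
      (endPt (stack π ρ (upperPt p))) := by
    intro p
    rw [stack, Perm.mul_apply, viaEmbedding_upperPt, startPt_upperPt]
    exact Setoid.trans' _ (.rel _ _ (.upper (pairing_apply π p))) (glue_pairing_upper π ρ (π p))
  rcases u with x | y | z
  · exact from_upper (.inl x)
  · exact from_upper (.inr y)
  · rw [stack_bottom]
    exact .rel _ _ (.lower (pairing_apply ρ (.inr z)))

theorem Reaches.glue_pairing {π ρ : Perm (Fin n ⊕ Fin n)} {u : Fin n ⊕ Fin n ⊕ Fin n}
    {p : Fin n ⊕ Fin n} (h : Reaches (stack π ρ) outerPt u p) :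
    glue (pairing π) (pairing ρ) (startPt u) (outerPt (minusPt p)) := by
  induction h with
  | @here u p h => exact endPt_outerPt p ▸ h ▸ glue_pairing_walk π ρ u
  | @step u p hu _ ih =>
    have hstart := (startPt_eq_endPt_or (stack π ρ u)).resolve_right fun ⟨q, hq⟩ => hu ⟨q, hq.symm⟩
    exact Setoid.trans' _ (hstart ▸ glue_pairing_walk π ρ u) ih

theorem Reaches.comp_pairing {π ρ : Perm (Fin n ⊕ Fin n)} {x y : Fin n ⊕ Fin n}
    (h : Reaches (stack π ρ) outerPt (outerPt x) y) :
    comp (pairing π) (pairing ρ) (plusPt x) (minusPt y) :=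
  show glue _ _ _ _ from startPt_outerPt x ▸ h.glue_pairing

theorem outerPt_injective {X Y Z : Type} : Function.Injective (outerPt : X ⊕ Z → X ⊕ Y ⊕ Z) :=
  Function.injective_id.sumMap Sum.inr_injective

theorem IsPlanar.next_comp_eq_of_reaches {a b : Setoid (Fin n ⊕ Fin n)} (ha : IsPlanar a)
    (hb : IsPlanar b) {x y : Fin n ⊕ Fin n}
    (h : Reaches (stack (next a) (next b)) outerPt (outerPt x) y) :
    next (CyclicDiagram.comp a b) x = y := by
  have hcomp := ha.comap_cycles_stack hb
  refine next_eq_iff.2 ⟨hcomp.le h.sameCycle, fun z hz hxz => ?_⟩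
  have hmatching : IsMatching (CyclicDiagram.comp (pairing (next a)) (pairing (next b))) :=
    (pairing_isMatching _).comp (pairing_isMatching _)
  have hplanar := ha.pairing_next.comp hb.pairing_next
  have arc_of_reaches : ∀ p ∈ {p | Arc x y p}, ∀ q,
      Reaches (stack (next a) (next b)) outerPt (outerPt p) q → q ∈ {p | Arc x y p} := by
    intro p hp q hpq
    have hxp : ¬ CyclicDiagram.comp (pairing (next a)) (pairing (next b)) (plusPt x)
        (plusPt p) := by
      intro hxp
      have hne : plusPt p ≠ plusPt x := fun g => by
        rw [plusPt_injective g, Set.mem_ofPred_eq, Arc] at hp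
        omega
      exact minusPt_ne_plusPt y p
        ((hmatching (plusPt x)).unique ⟨minusPt_ne_plusPt y x, h.comp_pairing⟩ ⟨hne, hxp⟩)
    exact arc_plus_minus_minus.1
      (hplanar.arc h.comp_pairing hpq.comp_pairing hxp (arc_plus_minus_plus.2 hp))
  have hx : Arc x y x := mem_of_sameCycle_of_reaches outerPt_injective arc_of_reaches
    (hcomp.ge (Setoid.symm' _ hxz)) hz
  rw [Arc] at hx
  omega

theorem IsPlanar.comp_pairing {a b : Setoid (Fin n ⊕ Fin n)} (ha : IsPlanar a)
    (hb : IsPlanar b) : CyclicDiagram.comp (pairing (next a)) (pairing (next b)) =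
      pairing (next (CyclicDiagram.comp a b)) := by
  refine ((pairing_isMatching _).eq_of_le ((pairing_isMatching _).comp (pairing_isMatching _))
    (pairing_le_iff.2 fun x => ?_)).symm
  obtain ⟨y, h⟩ := exists_reaches (stack (next a) (next b)) outerPt x
  exact ha.next_comp_eq_of_reaches hb h ▸ h.comp_pairing

/-- The point of the stacked diagram whose boundary walk contains a point of the doubled stacked
diagram. -/
noncomputable def walkPt (ρ : Perm (Fin n ⊕ Fin n)) :
    Fin (2 * n) ⊕ Fin (2 * n) ⊕ Fin (2 * n) → Fin n ⊕ Fin n ⊕ Fin n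
  | .inl x => Sum.elim outerPt outerPt (doublePts.symm (.inl x))
  | .inr q => Sum.elim Sum.inr
      (Sum.elim (fun y => .inr (ρ (.inl y))) fun z => .inr (.inr z)) (doublePts.symm q)

theorem walkPt_inr_minusPt (ρ : Perm (Fin n ⊕ Fin n)) (q : Fin n ⊕ Fin n) :
    walkPt ρ (.inr (minusPt q)) = .inr q := by
  rw [walkPt, doublePts_symm_minusPt, Sum.elim_inl]

theorem walkPt_inr_plusPt (ρ : Perm (Fin n ⊕ Fin n)) (q : Fin n ⊕ Fin n) :
    walkPt ρ (.inr (plusPt q)) =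
      Sum.elim (fun y => .inr (ρ (.inl y))) (fun z => .inr (.inr z)) q := by
  rw [walkPt, doublePts_symm_plusPt, Sum.elim_inr]

theorem walkPt_startPt (ρ : Perm (Fin n ⊕ Fin n)) (u : Fin n ⊕ Fin n ⊕ Fin n) :
    walkPt ρ (startPt u) = u := by
  rcases u with x | y | z
  · exact congrArg (Sum.elim outerPt outerPt) (doublePts_symm_plusPt (.inl x))
  · exact walkPt_inr_minusPt ρ (.inl y)
  · exact walkPt_inr_plusPt ρ (.inr z)

theorem walkPt_endPt (ρ : Perm (Fin n ⊕ Fin n)) (u : Fin n ⊕ Fin n ⊕ Fin n) :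
    walkPt ρ (endPt u) = u := by
  rcases u with x | p
  · exact congrArg (Sum.elim outerPt outerPt) (doublePts_symm_minusPt (.inl x))
  · exact walkPt_inr_minusPt ρ p

theorem walkPt_upperPt_minusPt (ρ : Perm (Fin n ⊕ Fin n)) (q : Fin n ⊕ Fin n) :
    walkPt ρ (upperPt (minusPt q)) = ρ.viaEmbedding lowerEmb (upperPt q) := by
  rcases q with x | y
  · exact (walkPt_endPt ρ (.inl x)).trans (viaEmbedding_lowerEmb_top ρ x).symm
  · exact (walkPt_inr_plusPt ρ (.inl y)).trans (viaEmbedding_lowerPt ρ (.inl y)).symm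

theorem glue_pairing_le (π ρ : Perm (Fin n ⊕ Fin n)) :
    glue (pairing π) (pairing ρ) ≤ (cycles (stack π ρ)).comap (walkPt ρ) := by
  refine glue_le_iff.2 ⟨pairing_le_iff.2 fun x => ?_, pairing_le_iff.2 fun x => ?_⟩
  · change cycles (stack π ρ) (walkPt ρ (upperPt (plusPt x))) (walkPt ρ (upperPt (minusPt (π x))))
    rw [walkPt_upperPt_minusPt, ← startPt_upperPt, walkPt_startPt, ← viaEmbedding_upperPt,
      ← Perm.mul_apply]
    exact cycles_apply_self _ _
  · change cycles (stack π ρ) (walkPt ρ (.inr (plusPt x))) (walkPt ρ (.inr (minusPt (ρ x))))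
    rw [walkPt_inr_minusPt, walkPt_inr_plusPt]
    rcases x with y | z
    · exact Setoid.refl' _ _
    · rw [Sum.elim_inr, ← stack_bottom π ρ z]
      exact cycles_apply_self _ _

theorem collapse_endPt_startPt (r : Setoid (Fin (2 * n) ⊕ Fin (2 * n) ⊕ Fin (2 * n)))
    (u : Fin n ⊕ Fin n ⊕ Fin n) : collapse r outerPt (endPt u) (startPt u) := by
  rcases startPt_eq_endPt_or u with h | ⟨p, rfl⟩
  · rw [h]
  · exact .inr ⟨⟨minusPt p, endPt_outerPt p ▸ r.refl _⟩, ⟨plusPt p, startPt_outerPt p ▸ r.refl _⟩⟩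

theorem collapse_startPt_walkPt (π ρ : Perm (Fin n ⊕ Fin n))
    (u : Fin (2 * n) ⊕ Fin (2 * n) ⊕ Fin (2 * n)) :
    collapse (glue (pairing π) (pairing ρ)) outerPt u (startPt (walkPt ρ u)) := by
  have of_endPt : ∀ v, collapse (glue (pairing π) (pairing ρ)) outerPt (endPt v)
      (startPt (walkPt ρ (endPt v))) := fun v => by
    rw [walkPt_endPt]
    exact collapse_endPt_startPt _ v
  have of_startPt : ∀ v, collapse (glue (pairing π) (pairing ρ)) outerPt (startPt v)
      (startPt (walkPt ρ (startPt v))) := fun v => by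
    rw [walkPt_startPt]
  rcases u with x | q
  · obtain ⟨p, h | h⟩ := eq_minusPt_or_plusPt (.inl x : Fin (2 * n) ⊕ Fin (2 * n))
    · have := of_endPt (outerPt p)
      rwa [endPt_outerPt, ← h] at this
    · have := of_startPt (outerPt p)
      rwa [startPt_outerPt, ← h] at this
  · obtain ⟨y | z, rfl | rfl⟩ := eq_minusPt_or_plusPt q
    · exact of_endPt (.inr (.inl y))
    · rw [walkPt_inr_plusPt, Sum.elim_inl]
      exact Setoid.trans' _ (.inl (.rel _ _ (.lower (pairing_apply ρ (.inl y)))))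
        (collapse_endPt_startPt _ (.inr (ρ (.inl y))))
    · exact of_endPt (.inr (.inr z))
    · exact of_startPt (.inr (.inr z))

theorem comap_walkPt_le_collapse (π ρ : Perm (Fin n ⊕ Fin n)) :
    (cycles (stack π ρ)).comap (walkPt ρ) ≤
      collapse (glue (pairing π) (pairing ρ)) outerPt := by
  have hcycles : cycles (stack π ρ) ≤
      (collapse (glue (pairing π) (pairing ρ)) outerPt).comap startPt :=
    cycles_le_iff.2 fun u =>
      Setoid.trans' (collapse _ outerPt) (.inl (glue_pairing_walk π ρ u))
        (collapse_endPt_startPt _ _)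
  exact fun u v h => Setoid.trans' _ (collapse_startPt_walkPt π ρ u)
    (Setoid.trans' _ (hcycles h) (Setoid.symm' _ (collapse_startPt_walkPt π ρ v)))

theorem range_walkPt_outerPt (ρ : Perm (Fin n ⊕ Fin n)) :
    Set.range (walkPt ρ ∘ outerPt) = Set.range outerPt := by
  refine Set.Subset.antisymm (Set.range_subset_iff.2 fun q => ?_)
    (Set.range_subset_iff.2 fun p => ?_)
  · obtain ⟨p, rfl | rfl⟩ := eq_minusPt_or_plusPt q
    · exact ⟨p, by rw [Function.comp_apply, ← endPt_outerPt, walkPt_endPt]⟩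
    · exact ⟨p, by rw [Function.comp_apply, ← startPt_outerPt, walkPt_startPt]⟩
  · exact ⟨plusPt p, by rw [Function.comp_apply, ← startPt_outerPt, walkPt_startPt]⟩

theorem internalCount_pairing (π ρ : Perm (Fin n ⊕ Fin n)) :
    internalCount (pairing π) (pairing ρ) = innerBlocks (cycles (stack π ρ)) outerPt := by
  have hsurj : (walkPt ρ).Surjective := fun u => ⟨startPt u, walkPt_startPt ρ u⟩
  exact (innerBlocks_congr (glue_pairing_le π ρ) (comap_walkPt_le_collapse π ρ)).trans
    (innerBlocks_comap _ hsurj (range_walkPt_outerPt ρ))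

theorem IsPlanar.internalCount_pairing {a b : Setoid (Fin n ⊕ Fin n)} (ha : IsPlanar a)
    (hb : IsPlanar b) : (internalCount (pairing (next a)) (pairing (next b)) : ℤ) =
      n + 2 * internalCount a b + blocks (CyclicDiagram.comp a b) - blocks a - blocks b := by
  have hstack := blocks_eq_innerBlocks_add (cycles (stack (next a) (next b))) outerPt
  have hglue : blocks (glue a b) = internalCount a b + blocks (CyclicDiagram.comp a b) :=
    blocks_eq_innerBlocks_add (glue a b) outerPt
  have heuler := ha.euler hb
  rw [ha.comap_cycles_stack hb, ← CyclicDiagram.internalCount_pairing] at hstack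
  rw [cycleCount] at heuler
  omega

end Walk

section Generators

variable {n : ℕ}

theorem pairing_next_eq {a : Setoid (Fin n ⊕ Fin n)} {r : Setoid (Fin (2 * n) ⊕ Fin (2 * n))}
    (hr : IsMatching r) (h : ∀ x, ∃ y, IsNext a x y ∧ r (plusPt x) (minusPt y)) :
    pairing (next a) = r := by
  refine (pairing_isMatching _).eq_of_le hr (pairing_le_iff.2 fun x => ?_)
  obtain ⟨y, hy, hxy⟩ := h x
  rwa [next_eq_iff.2 hy]

theorem pairing_next_idPart : pairing (next (idPart (Fin n))) = idPart (Fin (2 * n)) := by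
  refine pairing_next_eq (idPart_matching _) ?_
  rintro (j | j)
  · refine ⟨.inr j, ⟨by rw [idPart_rel]; rfl, ?_⟩, by rw [idPart_rel]; rfl⟩
    rintro (z | z) <;> simp only [idPart_rel, Arc, pos, Sum.elim_inl, Sum.elim_inr, id] <;> omega
  · refine ⟨.inl j, ⟨by rw [idPart_rel]; rfl, ?_⟩, by rw [idPart_rel]; rfl⟩
    rintro (z | z) <;> simp only [idPart_rel, Arc, pos, Sum.elim_inl, Sum.elim_inr, id] <;> omega

theorem isNext_stopPart_self {i : ℕ} {p : Fin n ⊕ Fin n} (h : (p.elim id id).val + 1 = i) :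
    IsNext (stopPart n i) p p := by
  refine ⟨Setoid.refl' _ _, fun q => ?_⟩
  rcases p with p | p <;> rcases q with q | q <;>
    simp only [stopPart_rel, Arc, pos, Sum.elim_inl, Sum.elim_inr, id, Sum.isLeft_inl,
      Sum.isLeft_inr, reduceCtorEq, true_or, false_or] at h ⊢ <;> omega

theorem isNext_stopPart_swap {i : ℕ} {p : Fin n ⊕ Fin n} (h : (p.elim id id).val + 1 ≠ i) :
    IsNext (stopPart n i) p p.swap := by
  refine ⟨?_, fun q => ?_⟩
  · rcases p with p | p <;> exact (stopPart_rel _ _ _).2 ⟨rfl, .inr h⟩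
  · rcases p with p | p <;> rcases q with q | q <;>
      simp only [stopPart_rel, Arc, pos, Sum.elim_inl, Sum.elim_inr, id, Sum.isLeft_inl,
        Sum.isLeft_inr, reduceCtorEq, true_or, false_or, Sum.swap_inl, Sum.swap_inr] <;> omega

theorem pairing_next_stopPart {i : ℕ} (hi : 1 ≤ i ∧ i ≤ n) :
    pairing (next (stopPart n i)) = hookPart (2 * n) (2 * i - 1) := by
  refine pairing_next_eq (hookPart_matching _ _ (by omega)) fun p => ?_
  by_cases h : (p.elim id id).val + 1 = i
  · refine ⟨p, isNext_stopPart_self h, ?_⟩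
    rcases p with p | p <;>
      simp only [hookPart_rel, plusPt, minusPt, Sum.map_inl, Sum.map_inr, Sum.elim_inl,
        Sum.elim_inr, id, Sum.isLeft_inl, Sum.isLeft_inr, true_and] at h ⊢ <;> omega
  · refine ⟨p.swap, isNext_stopPart_swap h, ?_⟩
    rcases p with p | p <;>
      simp only [hookPart_rel, plusPt, minusPt, Sum.map_inl, Sum.map_inr, Sum.elim_inl,
        Sum.elim_inr, id, Sum.swap_inl, Sum.swap_inr, true_and] at h ⊢ <;> omega

theorem isNext_bridgePart_inl {i k : ℕ} (hk : k + 1 < n) (h : k + 1 = i) :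
    IsNext (bridgePart n i) (.inl ⟨k, by omega⟩) (.inl ⟨k + 1, hk⟩) := by
  refine ⟨(bridgePart_rel _ _ _).2 (.inr ⟨.inl h, .inr h⟩), ?_⟩
  rintro (q | q) <;> simp only [Arc, pos] <;> omega

theorem isNext_bridgePart_inr {i k : ℕ} (hk : k + 1 < n) (h : k + 1 = i) :
    IsNext (bridgePart n i) (.inr ⟨k + 1, hk⟩) (.inr ⟨k, by omega⟩) := by
  refine ⟨(bridgePart_rel _ _ _).2 (.inr ⟨.inr h, .inl h⟩), ?_⟩
  rintro (q | q) <;> simp only [Arc, pos] <;> omega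

theorem isNext_bridgePart_inl_inr {i : ℕ} {j : Fin n} (h : j.val + 1 ≠ i) :
    IsNext (bridgePart n i) (.inl j) (.inr j) := by
  refine ⟨(bridgePart_rel _ _ _).2 (.inl rfl), ?_⟩
  rintro (q | q) <;> simp only [bridgePart_rel, Arc, pos, Sum.elim_inl, Sum.elim_inr, id] <;> omega

theorem isNext_bridgePart_inr_inl {i : ℕ} {j : Fin n} (h : j.val ≠ i) :
    IsNext (bridgePart n i) (.inr j) (.inl j) := by
  refine ⟨(bridgePart_rel _ _ _).2 (.inl rfl), ?_⟩
  rintro (q | q) <;> simp only [bridgePart_rel, Arc, pos, Sum.elim_inl, Sum.elim_inr, id] <;> omega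

theorem pairing_next_bridgePart {i : ℕ} (hi : 1 ≤ i ∧ i < n) :
    pairing (next (bridgePart n i)) = hookPart (2 * n) (2 * i) := by
  refine pairing_next_eq (hookPart_matching _ _ (by omega)) ?_
  rintro (⟨j, hj⟩ | ⟨j, hj⟩)
  · by_cases h : j + 1 = i
    · refine ⟨_, isNext_bridgePart_inl (h ▸ hi.2) h, ?_⟩
      simp only [hookPart_rel, plusPt, minusPt, Sum.map_inl, Sum.elim_inl, id,
        Sum.isLeft_inl, true_and]
      omega
    · refine ⟨_, isNext_bridgePart_inl_inr h, ?_⟩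
      simp only [hookPart_rel, plusPt, minusPt, Sum.map_inl, Sum.map_inr, Sum.elim_inl,
        Sum.elim_inr, id, true_and]
      omega
  · by_cases h : j = i
    · obtain ⟨k, rfl⟩ : ∃ k, j = k + 1 := ⟨j - 1, by omega⟩
      refine ⟨_, isNext_bridgePart_inr hj h, ?_⟩
      simp only [hookPart_rel, plusPt, minusPt, Sum.map_inr, Sum.elim_inr, id,
        Sum.isLeft_inr, true_and]
      omega
    · refine ⟨_, isNext_bridgePart_inr_inl h, ?_⟩
      simp only [hookPart_rel, plusPt, minusPt, Sum.map_inl, Sum.map_inr, Sum.elim_inl,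
        Sum.elim_inr, id, true_and]
      omega

theorem blocks_idPart : blocks (idPart (Fin n)) = n := by
  have h := Nat.card_congr (Setoid.quotientKerEquivOfSurjective
    (Sum.elim id id : Fin n ⊕ Fin n → Fin n) fun x => ⟨.inl x, rfl⟩)
  rwa [Nat.card_fin] at h

theorem joinBlocks_stopPart (k : Fin n) :
    joinBlocks (stopPart n (k + 1)) (.inl k) (.inr k) = idPart (Fin n) := by
  refine Setoid.ext fun p q => ?_
  rw [joinBlocks_apply]
  rcases p with p | p <;> rcases q with q | q <;>
    simp only [stopPart_rel, idPart_rel, Sum.elim_inl, Sum.elim_inr, id, Sum.isLeft_inl,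
      Sum.isLeft_inr, reduceCtorEq, true_or, false_or, and_true] <;> omega

theorem joinBlocks_idPart {k : ℕ} (hk : k + 1 < n) :
    joinBlocks (idPart (Fin n)) (.inl ⟨k, by omega⟩) (.inl ⟨k + 1, hk⟩) = bridgePart n (k + 1) := by
  refine Setoid.ext fun p q => ?_
  rw [joinBlocks_apply]
  rcases p with p | p <;> rcases q with q | q <;>
    simp only [bridgePart_rel, idPart_rel, Sum.elim_inl, Sum.elim_inr, id] <;> omega

theorem blocks_stopPart {i : ℕ} (hi : 1 ≤ i ∧ i ≤ n) : blocks (stopPart n i) = n + 1 := by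
  obtain ⟨k, rfl⟩ : ∃ k : Fin n, i = k + 1 := ⟨⟨i - 1, by omega⟩, (Nat.sub_add_cancel hi.1).symm⟩
  have hk : ¬ stopPart n (k + 1) (.inl k) (.inr k) := fun h =>
    ((stopPart_rel _ _ _).1 h).2.elim Bool.noConfusion fun h => h rfl
  rw [blocks_joinBlocks hk, joinBlocks_stopPart, blocks_idPart]

theorem blocks_bridgePart {i : ℕ} (hi : 1 ≤ i ∧ i < n) : blocks (bridgePart n i) + 1 = n := by
  obtain ⟨k, rfl⟩ : ∃ k, i = k + 1 := ⟨i - 1, (Nat.sub_add_cancel hi.1).symm⟩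
  have hk : ¬ idPart (Fin n) (.inl ⟨k, by omega⟩) (.inl ⟨k + 1, hi.2⟩) := fun h =>
    (Nat.succ_ne_self k).symm ((idPart_rel _ _).1 h)
  rw [← joinBlocks_idPart hi.2, ← blocks_joinBlocks hk, blocks_idPart]

end Generators

section Doubling

variable {m n : ℕ}

/-- Doubling, as a map from residues modulo `m` to residues modulo `2 * m`. -/
def residueDouble (m : ℕ) : ZMod m →+ ZMod (2 * m) :=
  ZMod.lift m ⟨zmultiplesHom (ZMod (2 * m)) 2, by
    rw [zmultiplesHom_apply, zsmul_eq_mul, Int.cast_natCast]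
    exact (mul_comm _ _).trans (by exact_mod_cast ZMod.natCast_self (2 * m))⟩

theorem residueDouble_intCast (k : ℤ) : residueDouble m k = 2 * k := by
  rw [residueDouble, ZMod.lift_coe, zmultiplesHom_apply, zsmul_eq_mul, mul_comm (2 : ZMod _)]

theorem residueDouble_injective : Function.Injective (residueDouble m) := by
  refine (injective_iff_map_eq_zero _).2 fun x hx => ?_
  obtain ⟨k, rfl⟩ := ZMod.intCast_surjective x
  rw [residueDouble_intCast] at hx
  have h : ((2 * k : ℤ) : ZMod (2 * m)) = 0 := by exact_mod_cast hx
  rw [ZMod.intCast_zmod_eq_zero_iff_dvd, Nat.cast_mul] at h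
  exact (ZMod.intCast_zmod_eq_zero_iff_dvd _ _).2 (Int.dvd_of_mul_dvd_mul_left two_ne_zero h)

/-- The number of internal components of the double of the diagram `(a, k)`. -/
noncomputable def doubleInternal (a : Setoid (Fin n ⊕ Fin n)) (k : ZMod m) : ZMod (2 * m) :=
  residueDouble m k + ((blocks a : ZMod (2 * m)) - n)

theorem doubleInternal_right_injective (a : Setoid (Fin n ⊕ Fin n)) :
    Function.Injective (doubleInternal a : ZMod m → ZMod (2 * m)) := fun _ _ h =>
  residueDouble_injective (add_right_cancel h)

theorem doubleInternal_idPart (k : ZMod m) :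
    doubleInternal (idPart (Fin n)) k = residueDouble m k := by
  rw [doubleInternal, blocks_idPart, sub_self, add_zero]

theorem doubleInternal_comp {a b : Setoid (Fin n ⊕ Fin n)} (ha : IsPlanar a) (hb : IsPlanar b)
    (k l : ZMod m) : doubleInternal (comp a b) (k + l + (internalCount a b : ZMod m)) =
      doubleInternal a k + doubleInternal b l +
        (internalCount (pairing (next a)) (pairing (next b)) : ZMod (2 * m)) := by
  have hinternal := congrArg (Int.cast : ℤ → ZMod (2 * m)) (ha.internalCount_pairing hb)
  have hdouble := residueDouble_intCast (m := m) (internalCount a b)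
  push_cast at hinternal hdouble
  rw [doubleInternal, doubleInternal, doubleInternal, map_add, map_add, hinternal, hdouble]
  ring

/-- The homomorphism that replaces every planar partition by the matching of the boundary points of
a neighbourhood of its blocks. -/
noncomputable def doubling (m n : ℕ) : PPa m n →* TL (2 * m) (2 * n) where
  toFun d := ⟨⟨pairing (next d.1.skeleton), doubleInternal d.1.skeleton d.1.internal⟩,
    IsPlanar.pairing_next d.2, pairing_isMatching _⟩
  map_one' := Subtype.ext (CyclicPartition.ext pairing_next_idPart
    ((doubleInternal_idPart 0).trans (map_zero _)))
  map_mul' d e := Subtype.ext (CyclicPartition.ext (IsPlanar.comp_pairing d.2 e.2).symm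
    (doubleInternal_comp d.2 e.2 _ _))

theorem doubling_injective : Function.Injective (doubling m n) := by
  intro d e h
  have hskeleton : d.1.skeleton = e.1.skeleton := next_injective (pairing_injective
    (congrArg (fun d : TL (2 * m) (2 * n) => d.1.skeleton) h))
  have hinternal : doubleInternal d.1.skeleton d.1.internal =
      doubleInternal e.1.skeleton e.1.internal :=
    congrArg (fun d : TL (2 * m) (2 * n) => d.1.internal) h
  rw [hskeleton] at hinternal
  exact Subtype.ext (CyclicPartition.ext hskeleton (doubleInternal_right_injective _ hinternal))

theorem TL.o_mul (d : TL m n) : (TL.o m n * d).1 = ⟨d.1.skeleton, 1 + d.1.internal⟩ := by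
  refine CyclicPartition.ext (idPart_comp _) ?_
  change 1 + d.1.internal + (internalCount (idPart (Fin n)) d.1.skeleton : ZMod m) = _
  rw [internalCount_idPart_left, Nat.cast_zero, add_zero]

theorem TL.o_pow_mul (k : ℕ) (d : TL m n) :
    (TL.o m n ^ k * d).1 = ⟨d.1.skeleton, k + d.1.internal⟩ := by
  induction k with
  | zero => rw [pow_zero, one_mul, Nat.cast_zero, zero_add]
  | succ k ih => rw [pow_succ', mul_assoc, TL.o_mul, ih, Nat.cast_succ, ← add_assoc, add_comm 1]

theorem doubling_p {i : ℕ} (h₁ : 1 ≤ i) (hn : i ≤ n) : doubling m n (PPa.p m n i) =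
    TL.o (2 * m) (2 * n) * TL.u (2 * m) (2 * n) (2 * i - 1) (by omega) := by
  refine Subtype.ext
    ((CyclicPartition.ext (pairing_next_stopPart ⟨h₁, hn⟩) ?_).trans (TL.o_mul _).symm)
  change residueDouble m 0 + (blocks (stopPart n i) - n) = (1 + 0 : ZMod (2 * m))
  rw [blocks_stopPart ⟨h₁, hn⟩, map_zero]
  push_cast
  ring

theorem doubling_pHalf (hm : 1 ≤ m) {i : ℕ} (h₁ : 1 ≤ i) (hn : i < n) :
    doubling m n (PPa.pHalf m n i) = TL.o (2 * m) (2 * n) ^ (2 * m - 1) *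
      TL.u (2 * m) (2 * n) (2 * i) (by omega) := by
  refine Subtype.ext
    ((CyclicPartition.ext (pairing_next_bridgePart ⟨h₁, hn⟩) ?_).trans (TL.o_pow_mul _ _).symm)
  change residueDouble m 0 + (blocks (bridgePart n i) - n) = ((2 * m - 1 : ℕ) + 0 : ZMod (2 * m))
  have hblocks : (blocks (bridgePart n i) + 1 : ZMod (2 * m)) = n := by
    exact_mod_cast congrArg Nat.cast (blocks_bridgePart ⟨h₁, hn⟩)
  rw [← hblocks, map_zero, Nat.cast_pred (by omega), ZMod.natCast_self]
  ring

theorem doubling_c : doubling m n (PPa.c m n) = TL.o (2 * m) (2 * n) ^ 2 := by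
  rw [sq]
  refine Subtype.ext ((CyclicPartition.ext pairing_next_idPart ?_).trans (TL.o_mul _).symm)
  change doubleInternal (idPart (Fin n)) 1 = (1 + 1 : ZMod (2 * m))
  have htwo := residueDouble_intCast (m := m) 1
  rw [Int.cast_one, Int.cast_one, mul_one] at htwo
  rw [doubleInternal_idPart, htwo, one_add_one_eq_two]

end Doubling

end CyclicDiagram

theorem propositionP (m n : ℕ) (hm : 1 ≤ m) :
    ∃ f : CyclicDiagram.PPa m n →* CyclicDiagram.TL (2 * m) (2 * n),
      Function.Injective f ∧
      (∀ (i : ℕ) (hi : 1 ≤ i ∧ i ≤ n), f (CyclicDiagram.PPa.p m n i) =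
        CyclicDiagram.TL.o (2 * m) (2 * n) *
          CyclicDiagram.TL.u (2 * m) (2 * n) (2 * i - 1) (by omega)) ∧
      (∀ (i : ℕ) (hi : 1 ≤ i ∧ i < n), f (CyclicDiagram.PPa.pHalf m n i) =
        CyclicDiagram.TL.o (2 * m) (2 * n) ^ (2 * m - 1) *
          CyclicDiagram.TL.u (2 * m) (2 * n) (2 * i) (by omega)) ∧
      f (CyclicDiagram.PPa.c m n) = CyclicDiagram.TL.o (2 * m) (2 * n) ^ 2 := by
  open CyclicDiagram in
  exact ⟨doubling m n, doubling_injective, fun _ hi => doubling_p hi.1 hi.2,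
    fun _ hi => doubling_pHalf hm hi.1 hi.2, doubling_c⟩
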